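/- For $\mu=(\mu_1,\mu_2)\in\mathbb R^2$ let $G_\mu=\frac12 N(\mu_1,1)+\frac12 N(\mu_2,1)$, and for $\mu^*\in\mathbb R^2$ let $f_{\mu^*}(\mu)=d_{TV}(G_\mu,G_{\mu^*})=\frac12\int_{\mathbb R}|G_\mu(x)-G_{\mu^*}(x)|\,dx$ (densities). All parameter vectors are written with $\mu_1\le\mu_2$. Let $B(C)=\{v:|v_1|,|v_2|\le C\}$, $\mathrm{Sep}(\gamma)=\{v:|v_1-v_2|>\gamma\}$ and $\mathrm{Uni}(\delta)=\{v:|v_i-\mu^*_i|<\delta\text{ for }i=1,2\}$; let $L(\mu,\mu')$ be the line segment between $\mu$ and $\mu'$. Say that a pair $(c,p)$ of positive reals is a gradient bound if, for all $C\ge1\ge\gamma\ge\delta>0$ and all $\mu^*\in B(C)\cap\mathrm{Sep}(\gamma)$, $\hat\mu\in B(C)\cap\mathrm{Sep}(\delta)$ with $\hat\mu_i\ne\mu^*_j$ for all $i,j$, the function $f_{\mu^*}$ is differentiable at $\hat\mu$ and $\|\nabla f_{\mu^*}(\hat\mu)\|_2\ge c\,(\delta e^{-C^2}/C)^{p}$.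 Gradient bounds exist. Moreover, for every gradient bound $(c,p)$ there are constants $c',p',\delta_0>0$, depending only on $c$ and $p$, such that the following holds. Let $C\ge1$ and $\gamma\ge\delta>0$ with $\delta\le\delta_0$, and put $K=c\,(\delta e^{-C^2}/C)^{p}$. Let $\mu^*,\hat\mu,\hat\mu'\in B(C)$ with $\mu^*\in\mathrm{Sep}(\gamma)$, $\hat\mu,\hat\mu'\in\mathrm{Sep}(\delta)$ and $L(\hat\mu,\hat\mu')\cap\mathrm{Uni}(\delta)=\emptyset$. If $\|\hat\mu'-\hat\mu\|_2\le c'\,(\delta e^{-C^2}/C)^{p'}$, then $f_{\mu^*}$ is differentiable at $\hat\mu$ and $\hat\mu'$ and $$\|\nabla f_{\mu^*}(\hat\mu')-\nabla f_{\mu^*}(\hat\mu)\|_2\le \frac K2\le\frac{\|\nabla f_{\mu^*}(\hat\mu)\|_2}{2}.$$ -/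

import Mathlib

noncomputable section

/-- The plane `ℝ²` of parameter vectors, with the Euclidean norm; the two means are the
coordinates `0` and `1`. -/
abbrev Params : Type := EuclideanSpace ℝ (Fin 2)

/-- Density of the uniform mixture `½ N(μ₁, 1) + ½ N(μ₂, 1)`. -/
def mixDensity (μ : Params) (x : ℝ) : ℝ :=
  (1 / 2) * ProbabilityTheory.gaussianPDFReal (μ 0) 1 x +
    (1 / 2) * ProbabilityTheory.gaussianPDFReal (μ 1) 1 x

/-- Total variation distance of two distributions on `ℝ` given by their densities. -/
def tvDist (P Q : ℝ → ℝ) : ℝ := (1 / 2) * ∫ x : ℝ, |P x - Q x|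

/-- The objective `f_{μ*}(μ) = d_TV(G_μ, G_{μ*})`, as a function of the second argument. -/
def tvLoss (μstar : Params) (μ : Params) : ℝ := tvDist (mixDensity μ) (mixDensity μstar)

/-- The box `B(C)`. -/
def box (C : ℝ) : Set Params := {v | ∀ i, |v i| ≤ C}

/-- Parameter vectors whose two means are more than `γ` apart. -/
def sepSet (γ : ℝ) : Set Params := {v | γ < |v 0 - v 1|}

/-- Parameter vectors all of whose coordinates are `δ`-close to those of `μ*`. -/
def uniSet (μstar : Params) (δ : ℝ) : Set Params := {v | ∀ i, |v i - μstar i| < δ}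

/-- The quantity `c (δ e^{-C²} / C)^p`; with absolute constants `c, p > 0` this is what is
written `Ω(1) · (δ e^{-C²} / C)^{O(1)}`. -/
def polyRate (c p C δ : ℝ) : ℝ := c * (δ * Real.exp (-C ^ 2) / C) ^ p

/-- `K = polyRate c p C δ` is, for all admissible parameters, a lower bound for the norm of the
gradient of the objective at every point sharing no coordinate with `μ*`. The coordinates of the
parameter vectors are listed in increasing order. -/
def IsGradBound (c p : ℝ) : Prop :=
  ∀ C γ δ : ℝ, 1 ≤ C → γ ≤ 1 → δ ≤ γ → 0 < δ →
    ∀ μstar μ : Params, μstar 0 ≤ μstar 1 → μ 0 ≤ μ 1 →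
      (∀ i j, μ i ≠ μstar j) →
      μstar ∈ box C → μ ∈ box C → μstar ∈ sepSet γ → μ ∈ sepSet δ →
      DifferentiableAt ℝ (tvLoss μstar) μ ∧
        polyRate c p C δ ≤ ‖gradient (tvLoss μstar) μ‖

end

open MeasureTheory Filter Topology Set

/-! Write `D` for `mixDiff`, the difference of the two densities. It is analytic, so unless it
vanishes identically it is nonzero almost everywhere; then the total variation distance is
differentiable, and its partial derivatives are `gradComp`, integrals of `sign D` against `t * φ(t)`
centred at a mean of `μ`.

A gradient bound exists by comparing the order of the means. If both means are shifted the same way,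
`sign D` is known outside the span of the extreme means, and one partial derivative is bounded away
from zero. If one pair of means is nested in the other, `sign D` is constant on an interval and
opposite outside it, so each partial derivative is half a difference, up to sign, of Gaussian values
at the two endpoints. The midpoint of the interval cannot be near both means of `μ`, hence one of
the differences is large.

For stability, moving `μ` by `ρ` can change `sign D` only where `|D| ≤ ρ`, so the task is to bound
the measure of that set (`abs_gradComp_sub_le`). Up to a Gaussian factor `D` is a sum of four
exponentials whose frequencies are the means. Outside `Uni(δ)` one frequency is isolated; three
first-order operators remove the others and leave a single exponential, which is not small. Each
operator costs one sublevel estimate (`volume_sublevel_le_of_deriv_ge`), and every loss is a power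
of `t = δ e^{-C²} / C`.

A gradient bound says nothing at points sharing a coordinate with `μ*`. There the inequality follows
from nearby points by the same stability estimate (`polyRate_le_norm_gradient`). -/

/-! ### The standard Gaussian and the integrals of its first moment. -/

/-- The standard normal density. -/
noncomputable def stdGauss (t : ℝ) : ℝ := (√(2 * Real.pi))⁻¹ * Real.exp (-t ^ 2 / 2)

/-- The negative derivative of the standard normal density. -/
noncomputable def stdGaussMoment (t : ℝ) : ℝ := t * stdGauss t

theorem gaussianPDFReal_one_eq_stdGauss (m x : ℝ) :
    ProbabilityTheory.gaussianPDFReal m 1 x = stdGauss (x - m) := by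
  simp [ProbabilityTheory.gaussianPDFReal, stdGauss]

theorem stdGauss_pos (t : ℝ) : 0 < stdGauss t := by
  unfold stdGauss; positivity

theorem two_lt_sqrt_two_pi : 2 < √(2 * Real.pi) := by
  apply Real.lt_sqrt_of_sq_lt
  nlinarith [Real.pi_gt_three]

theorem sqrt_two_pi_lt_three : √(2 * Real.pi) < 3 := by
  rw [Real.sqrt_lt' (by norm_num)]
  nlinarith [Real.pi_lt_four]

theorem stdGauss_le_half_mul (t : ℝ) : stdGauss t ≤ 1 / 2 * Real.exp (-t ^ 2 / 2) := by
  unfold stdGauss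
  gcongr
  rw [inv_le_comm₀ (by positivity) (by norm_num)]
  simpa only [one_div, inv_inv] using two_lt_sqrt_two_pi.le

theorem third_mul_le_stdGauss (t : ℝ) : 1 / 3 * Real.exp (-t ^ 2 / 2) ≤ stdGauss t := by
  unfold stdGauss
  gcongr
  rw [le_inv_comm₀ (by norm_num) (by positivity)]
  simpa only [one_div, inv_inv] using sqrt_two_pi_lt_three.le

theorem stdGauss_lt_of_sq_lt {s t : ℝ} (h : s ^ 2 < t ^ 2) : stdGauss t < stdGauss s := by
  unfold stdGauss
  gcongr

theorem stdGauss_le_of_sq_le {s t : ℝ} (h : s ^ 2 ≤ t ^ 2) : stdGauss t ≤ stdGauss s := by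
  unfold stdGauss
  gcongr

theorem stdGauss_neg (t : ℝ) : stdGauss (-t) = stdGauss t := by
  simp [stdGauss]

theorem hasDerivAt_stdGauss (t : ℝ) : HasDerivAt stdGauss (-stdGaussMoment t) t := by
  have h : HasDerivAt (fun s : ℝ => -s ^ 2 / 2) (-t) t := by
    have := ((hasDerivAt_pow 2 t).neg).div_const 2
    exact this.congr_deriv (by push_cast; ring)
  refine (h.exp.const_mul (√(2 * Real.pi))⁻¹).congr_deriv ?_
  simp only [stdGaussMoment, stdGauss]; ring

theorem hasDerivAt_stdGaussMoment (t : ℝ) :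
    HasDerivAt stdGaussMoment ((1 - t ^ 2) * stdGauss t) t := by
  refine ((hasDerivAt_id t).mul (hasDerivAt_stdGauss t)).congr_deriv ?_
  simp only [stdGaussMoment, id]; ring

theorem continuous_stdGauss : Continuous stdGauss := by
  unfold stdGauss; fun_prop

theorem integrable_stdGauss : Integrable stdGauss := by
  unfold stdGauss
  have := (integrable_exp_neg_mul_sq (b := 1 / 2) (by norm_num)).const_mul (√(2 * Real.pi))⁻¹
  convert this using 4
  ring

theorem integrable_stdGaussMoment : Integrable stdGaussMoment := by
  unfold stdGaussMoment stdGauss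
  have := (integrable_mul_exp_neg_mul_sq (b := 1 / 2) (by norm_num)).const_mul (√(2 * Real.pi))⁻¹
  convert this using 2 with x
  rw [show -x ^ 2 / 2 = -(1 / 2) * x ^ 2 by ring]
  ring

theorem abs_stdGaussMoment_le (t : ℝ) :
    |stdGaussMoment t| ≤ Real.exp (-t ^ 2 / 4) := by
  have h1 := stdGauss_le_half_mul t
  have h2 : |t| ≤ 2 * Real.exp (t ^ 2 / 4) := by
    have := Real.add_one_le_exp (t ^ 2 / 4)
    have h3 := sq_abs t
    nlinarith [sq_nonneg (|t| - 1)]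
  rw [stdGaussMoment, abs_mul, abs_of_pos (stdGauss_pos t)]
  calc |t| * stdGauss t ≤ (2 * Real.exp (t ^ 2 / 4)) * (1 / 2 * Real.exp (-t ^ 2 / 2)) := by
        gcongr; exact (stdGauss_pos t).le
    _ = Real.exp (t ^ 2 / 4) * Real.exp (-t ^ 2 / 2) := by ring
    _ = _ := by rw [← Real.exp_add]; congr 1; ring

theorem abs_stdGaussMoment_le_one (t : ℝ) : |stdGaussMoment t| ≤ 1 :=
  (abs_stdGaussMoment_le t).trans (Real.exp_le_one_iff.2 (by nlinarith [sq_nonneg t]))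

theorem abs_one_sub_sq_mul_stdGauss_le (t : ℝ) : |(1 - t ^ 2) * stdGauss t| ≤ 1 := by
  have h1 := stdGauss_le_half_mul t
  have h2 : |1 - t ^ 2| ≤ 2 * Real.exp (t ^ 2 / 2) := by
    have := Real.add_one_le_exp (t ^ 2 / 2)
    rw [abs_le]; constructor <;> nlinarith [sq_nonneg t]
  rw [abs_mul, abs_of_pos (stdGauss_pos t)]
  calc |1 - t ^ 2| * stdGauss t ≤ (2 * Real.exp (t ^ 2 / 2)) * (1 / 2 * Real.exp (-t ^ 2 / 2)) := by
        gcongr; exact (stdGauss_pos t).le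
    _ = Real.exp (t ^ 2 / 2) * Real.exp (-t ^ 2 / 2) := by ring
    _ = 1 := by rw [← Real.exp_add, show t ^ 2 / 2 + -t ^ 2 / 2 = 0 by ring, Real.exp_zero]

theorem abs_stdGauss_sub_le (s t : ℝ) : |stdGauss s - stdGauss t| ≤ |s - t| := by
  have := convex_univ.norm_image_sub_le_of_norm_hasDerivWithin_le (f := stdGauss)
    (f' := fun x => -stdGaussMoment x) (C := 1) (x := t) (y := s)
    (fun x _ => (hasDerivAt_stdGauss x).hasDerivWithinAt)
    (fun x _ => by rw [norm_neg]; exact abs_stdGaussMoment_le_one x) trivial trivial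
  simpa using this

theorem abs_stdGaussMoment_sub_le (s t : ℝ) :
    |stdGaussMoment s - stdGaussMoment t| ≤ |s - t| := by
  have := convex_univ.norm_image_sub_le_of_norm_hasDerivWithin_le (f := stdGaussMoment)
    (f' := fun x => (1 - x ^ 2) * stdGauss x) (C := 1) (x := t) (y := s)
    (fun x _ => (hasDerivAt_stdGaussMoment x).hasDerivWithinAt)
    (fun x _ => abs_one_sub_sq_mul_stdGauss_le x) trivial trivial
  simpa using this

theorem tendsto_stdGauss_atTop : Tendsto stdGauss atTop (𝓝 0) := by
  unfold stdGauss
  rw [show (0 : ℝ) = (√(2 * Real.pi))⁻¹ * 0 by ring]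
  apply Tendsto.const_mul
  apply Real.tendsto_exp_atBot.comp
  have : Tendsto (fun t : ℝ => t ^ 2 / 2) atTop atTop :=
    (tendsto_pow_atTop two_ne_zero).atTop_div_const two_pos
  refine (tendsto_neg_atTop_atBot.comp this).congr fun t => ?_
  simp only [Function.comp]; ring

theorem tendsto_stdGauss_atBot : Tendsto stdGauss atBot (𝓝 0) := by
  refine (tendsto_stdGauss_atTop.comp tendsto_neg_atBot_atTop).congr fun t => ?_
  simp [stdGauss_neg]

theorem hasDerivAt_neg_stdGauss_sub (m x : ℝ) :
    HasDerivAt (fun x => -stdGauss (x - m)) (stdGaussMoment (x - m)) x := by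
  have := ((hasDerivAt_stdGauss (x - m)).comp_sub_const x m).neg
  rw [neg_neg] at this
  exact this

theorem integral_Ioi_stdGaussMoment (m a : ℝ) :
    ∫ x in Ioi a, stdGaussMoment (x - m) = stdGauss (a - m) := by
  have h := integral_Ioi_of_hasDerivAt_of_tendsto' (a := a)
    (fun x _ => hasDerivAt_neg_stdGauss_sub m x)
    ((integrable_stdGaussMoment.comp_sub_right m).integrableOn) (m := 0) (by
      have := (tendsto_stdGauss_atTop.comp (tendsto_atTop_add_const_right atTop (-m) tendsto_id)).neg
      simpa [Function.comp_def, sub_eq_add_neg] using this)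
  rw [h]; ring

theorem integral_Iic_stdGaussMoment (m a : ℝ) :
    ∫ x in Iic a, stdGaussMoment (x - m) = -stdGauss (a - m) := by
  have h := integral_Iic_of_hasDerivAt_of_tendsto' (a := a)
    (fun x _ => hasDerivAt_neg_stdGauss_sub m x)
    ((integrable_stdGaussMoment.comp_sub_right m).integrableOn) (m := 0) (by
      have := (tendsto_stdGauss_atBot.comp (tendsto_atBot_add_const_right atBot (-m) tendsto_id)).neg
      simpa [Function.comp_def, sub_eq_add_neg] using this)
  rw [h]; ring

theorem integral_Ioc_stdGaussMoment (m : ℝ) {a b : ℝ} (hab : a ≤ b) :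
    ∫ x in Ioc a b, stdGaussMoment (x - m) = stdGauss (a - m) - stdGauss (b - m) := by
  rw [← intervalIntegral.integral_of_le hab,
    intervalIntegral.integral_eq_sub_of_hasDerivAt (f := fun x => -stdGauss (x - m))
      (fun x _ => hasDerivAt_neg_stdGauss_sub m x)
      ((integrable_stdGaussMoment.comp_sub_right m).intervalIntegrable)]
  ring

/-! ### Differentiability of the total variation loss. -/

/-- Difference of the two mixture densities. -/
noncomputable def mixDiff (μstar μ : Params) (x : ℝ) : ℝ := mixDensity μ x - mixDensity μstar x

theorem mixDiff_eq (μstar μ : Params) (x : ℝ) :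
    mixDiff μstar μ x = 1 / 2 * (stdGauss (x - μ 0) + stdGauss (x - μ 1)
      - stdGauss (x - μstar 0) - stdGauss (x - μstar 1)) := by
  simp only [mixDiff, mixDensity, gaussianPDFReal_one_eq_stdGauss]; ring

theorem continuous_mixDiff (μstar μ : Params) : Continuous (mixDiff μstar μ) := by
  have := continuous_stdGauss
  have : mixDiff μstar μ = _ := funext (mixDiff_eq μstar μ)
  rw [this]; fun_prop

theorem analyticOnNhd_mixDiff (μstar μ : Params) : AnalyticOnNhd ℝ (mixDiff μstar μ) univ := by
  have h : ∀ m : ℝ, AnalyticOnNhd ℝ (fun x => stdGauss (x - m)) univ := by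
    intro m x _
    unfold stdGauss
    fun_prop
  have : mixDiff μstar μ = _ := funext (mixDiff_eq μstar μ)
  rw [this]
  exact analyticOnNhd_const.mul ((((h _).add (h _)).sub (h _)).sub (h _))

/-- The zeros of an analytic function that is not identically zero form a discrete, hence null, set.
-/
theorem ae_mixDiff_ne_zero {μstar μ : Params} {x₀ : ℝ} (h : mixDiff μstar μ x₀ ≠ 0) :
    ∀ᵐ x : ℝ, mixDiff μstar μ x ≠ 0 := by
  have h1 := (analyticOnNhd_mixDiff μstar μ).preimage_zero_mem_codiscrete h
  have h2 := ae_restrict_le_codiscreteWithin (μ := (volume : Measure ℝ)) MeasurableSet.univ h1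
  rw [Measure.restrict_univ] at h2
  filter_upwards [h2] with x hx using hx

/-- Coordinates of the gradient of `tvLoss μstar` at `μ`. -/
noncomputable def gradComp (μstar μ : Params) (i : Fin 2) : ℝ :=
  1 / 4 * ∫ x, SignType.sign (mixDiff μstar μ x) * stdGaussMoment (x - μ i)

theorem measurable_sign_mixDiff (μstar μ : Params) :
    Measurable fun x => ((SignType.sign (mixDiff μstar μ x) : SignType) : ℝ) := by
  have h := (continuous_mixDiff μstar μ).measurable
  have : (fun x => ((SignType.sign (mixDiff μstar μ x) : SignType) : ℝ)) = fun x =>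
      if 0 < mixDiff μstar μ x then 1 else if mixDiff μstar μ x < 0 then -1 else 0 := by
    funext x
    split_ifs with h1 h2
    · simp [h1]
    · simp [h2]
    · have : mixDiff μstar μ x = 0 := by linarith
      simp [this]
  rw [this]
  exact Measurable.ite (measurableSet_lt measurable_const h) measurable_const
    (Measurable.ite (measurableSet_lt h measurable_const) measurable_const measurable_const)

theorem abs_sign_le_one (y : ℝ) : |((SignType.sign y : SignType) : ℝ)| ≤ 1 := by
  rcases lt_trichotomy y 0 with h | h | h <;> simp [h]

theorem integrable_sign_mul_stdGaussMoment (μstar μ : Params) (m : ℝ) :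
    Integrable fun x => ((SignType.sign (mixDiff μstar μ x) : SignType) : ℝ) *
      stdGaussMoment (x - m) := by
  refine (integrable_stdGaussMoment.comp_sub_right m).bdd_mul (c := 1)
    (measurable_sign_mixDiff μstar μ).aestronglyMeasurable (ae_of_all _ fun x => ?_)
  exact abs_sign_le_one _

/-- Supplies the dominating function for differentiation under the integral. For `|s| ≤ 1`, `(y -
s)² ≥ y²/2 - 1`, so recentring costs half the exponent and a factor `e^{1/4} ≤ 2`. -/
theorem abs_stdGauss_sub_le_of_near {m₀ m m' x : ℝ} (h : |m - m₀| ≤ 1) (h' : |m' - m₀| ≤ 1) :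
    |stdGauss (x - m) - stdGauss (x - m')| ≤ 2 * Real.exp (-(x - m₀) ^ 2 / 8) * |m - m'| := by
  have := (convex_Icc (-1 : ℝ) 1).norm_image_sub_le_of_norm_hasDerivWithin_le
    (f := fun s => stdGauss (x - m₀ - s))
    (f' := fun s => stdGaussMoment (x - m₀ - s)) (C := 2 * Real.exp (-(x - m₀) ^ 2 / 8))
    (x := m' - m₀) (y := m - m₀)
    (fun s _ => by
      have := (hasDerivAt_stdGauss (x - m₀ - s)).comp s ((hasDerivAt_id s).const_sub (x - m₀))
      have := this.hasDerivWithinAt (s := Icc (-1 : ℝ) 1)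
      simpa [Function.comp_def] using this)
    (fun s hs => by
      refine (abs_stdGaussMoment_le _).trans ?_
      have h1 : (1 : ℝ) + 1 / 4 ≤ 2 := by norm_num
      have h2 : Real.exp (1 / 4) ≤ 2 := by
        have h3 : Real.exp (1 / 4) ^ 4 ≤ 2 ^ 4 := by
          rw [← Real.exp_nat_mul]; norm_num
          linarith [Real.exp_one_lt_d9]
        exact le_of_pow_le_pow_left₀ (by norm_num) (by norm_num) h3
      calc Real.exp (-(x - m₀ - s) ^ 2 / 4) ≤ Real.exp (1 / 4 + -(x - m₀) ^ 2 / 8) := by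
            gcongr
            have : s ^ 2 ≤ 1 := by nlinarith [hs.1, hs.2]
            nlinarith [sq_nonneg (x - m₀ - 2 * s)]
        _ = Real.exp (1 / 4) * Real.exp (-(x - m₀) ^ 2 / 8) := Real.exp_add _ _
        _ ≤ _ := by gcongr)
    (abs_le.1 h') (abs_le.1 h)
  simpa using this

theorem abs_sub_le_norm_sub (u v : Params) (i : Fin 2) : |u i - v i| ≤ ‖u - v‖ := by
  simpa using PiLp.norm_apply_le (u - v) i

theorem hasFDerivAt_mixDiff (μstar μ : Params) (x : ℝ) :
    HasFDerivAt (fun ν => mixDiff μstar ν x)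
      ((1 / 2 * stdGaussMoment (x - μ 0)) • (EuclideanSpace.proj 0 : Params →L[ℝ] ℝ) +
        (1 / 2 * stdGaussMoment (x - μ 1)) • (EuclideanSpace.proj 1 : Params →L[ℝ] ℝ)) μ := by
  have h : ∀ i : Fin 2, HasFDerivAt (fun ν : Params => stdGauss (x - ν i))
      (stdGaussMoment (x - μ i) • (EuclideanSpace.proj i : Params →L[ℝ] ℝ)) μ := by
    intro i
    have h1 : HasFDerivAt (fun ν : Params => x - ν i)
        (-(EuclideanSpace.proj i : Params →L[ℝ] ℝ)) μ :=
      ((EuclideanSpace.proj i : Params →L[ℝ] ℝ).hasFDerivAt).const_sub x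
    have := (hasDerivAt_stdGauss (x - μ i)).comp_hasFDerivAt μ h1
    simpa [Function.comp_def] using this
  have : (fun ν => mixDiff μstar ν x) = _ := funext fun ν => mixDiff_eq μstar ν x
  rw [this]
  have := ((((h 0).add (h 1)).sub_const (stdGauss (x - μstar 0))).sub_const
    (stdGauss (x - μstar 1))).const_mul (1 / 2)
  exact this.congr_fderiv (by rw [smul_add, smul_smul, smul_smul])

theorem integrable_mixDiff (μstar μ : Params) : Integrable (mixDiff μstar μ) := by
  have h := fun m : ℝ => integrable_stdGauss.comp_sub_right m
  have : mixDiff μstar μ = _ := funext (mixDiff_eq μstar μ)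
  rw [this]
  exact ((((h _).add (h _)).sub (h _)).sub (h _)).const_mul _

theorem hasGradientAt_tvLoss {μstar μ : Params} (h0 : ∀ᵐ x : ℝ, mixDiff μstar μ x ≠ 0) :
    HasGradientAt (tvLoss μstar) !₂[gradComp μstar μ 0, gradComp μstar μ 1] μ := by
  set s : ℝ → ℝ := fun x => ((SignType.sign (mixDiff μstar μ x) : SignType) : ℝ) with hs
  set F' : ℝ → Params →L[ℝ] ℝ := fun x =>
    (s x * (1 / 2 * stdGaussMoment (x - μ 0))) • (EuclideanSpace.proj 0 : Params →L[ℝ] ℝ) +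
      (s x * (1 / 2 * stdGaussMoment (x - μ 1))) • (EuclideanSpace.proj 1 : Params →L[ℝ] ℝ) with hF'
  have hint : ∀ i, Integrable fun x => s x * (1 / 2 * stdGaussMoment (x - μ i)) := by
    intro i
    have := (integrable_sign_mul_stdGaussMoment μstar μ (μ i)).const_mul (1 / 2)
    refine this.congr (ae_of_all _ fun x => ?_)
    simp only [hs]; ring
  have hsm : ∀ i, Integrable fun x => (s x * (1 / 2 * stdGaussMoment (x - μ i))) •
      (EuclideanSpace.proj i : Params →L[ℝ] ℝ) := fun i => (hint i).smul_const _
  have hF'int : Integrable F' :=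
    Integrable.add (ε' := Params →L[ℝ] ℝ) (hsm 0) (hsm 1)
  -- The factor 2 of `abs_stdGauss_sub_le_of_near` cancels the mixture weight 1/2.
  set bound : ℝ → ℝ := fun x =>
    Real.exp (-(x - μ 0) ^ 2 / 8) + Real.exp (-(x - μ 1) ^ 2 / 8) with hbound
  have hb : ∀ m : ℝ, Integrable fun x : ℝ => Real.exp (-(x - m) ^ 2 / 8) := by
    intro m
    have := (integrable_exp_neg_mul_sq (b := 1 / 8) (by norm_num)).comp_sub_right m
    refine this.congr (ae_of_all _ fun x => ?_)
    simp only []; congr 1; ring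
  have key := hasFDerivAt_integral_of_dominated_loc_of_lip (μ := (volume : Measure ℝ))
    (F := fun ν x => |mixDiff μstar ν x|) (x₀ := μ) (F' := F') (bound := bound)
    (s := Metric.ball μ 1) (𝕜 := ℝ) (Metric.ball_mem_nhds μ one_pos)
    (Eventually.of_forall fun ν => (continuous_mixDiff μstar ν).abs.aestronglyMeasurable)
    (integrable_mixDiff μstar μ).abs hF'int.aestronglyMeasurable
    (ae_of_all _ fun x => by
      refine LipschitzOnWith.of_dist_le_mul fun ν hν ν' hν' => ?_
      rw [mem_ball_iff_norm] at hν hν'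
      have hbp : 0 ≤ bound x := by positivity
      rw [Real.coe_nnabs, abs_of_nonneg hbp, Real.dist_eq, dist_eq_norm]
      refine (abs_abs_sub_abs_le_abs_sub _ _).trans ?_
      rw [mixDiff_eq, mixDiff_eq]
      have e : ∀ i, |stdGauss (x - ν i) - stdGauss (x - ν' i)| ≤
          2 * Real.exp (-(x - μ i) ^ 2 / 8) * ‖ν - ν'‖ := by
        intro i
        refine (abs_stdGauss_sub_le_of_near ((abs_sub_le_norm_sub ν μ i).trans hν.le)
          ((abs_sub_le_norm_sub ν' μ i).trans hν'.le)).trans ?_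
        gcongr
        exact abs_sub_le_norm_sub ν ν' i
      have e0 := abs_le.1 (e 0)
      have e1 := abs_le.1 (e 1)
      simp only [hbound]
      rw [abs_le]
      constructor <;> nlinarith [e0.1, e0.2, e1.1, e1.2])
    ((hb _).add (hb _))
    (by
      filter_upwards [h0] with x hx
      have h1 := hasFDerivAt_mixDiff μstar μ x
      have h2 := (hasDerivAt_abs hx).comp_hasFDerivAt μ h1
      exact h2.congr_fderiv (by simp only [hF', hs, smul_add, smul_smul]))
  have h2 := key.2.const_mul (1 / 2)
  rw [hasGradientAt_iff_hasFDerivAt]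
  refine h2.congr_fderiv ?_
  ext v
  simp only [hF']
  rw [integral_add (hsm 0) (hsm 1), integral_smul_const,
    integral_smul_const]
  have hc : ∀ i, ∫ x, s x * (1 / 2 * stdGaussMoment (x - μ i)) = 2 * gradComp μstar μ i := by
    intro i
    simp only [gradComp, hs]
    rw [← mul_assoc, ← integral_const_mul]
    congr 1; funext x; ring
  rw [hc 0, hc 1]
  simp [PiLp.inner_apply, Fin.sum_univ_two]
  ring

/-- With the leftmost mean `a` in the first pair, either both means of that pair lie weakly to the
left, and it is larger at `a - 1`, or the second pair is nested in it, and the second is larger at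
its own left mean `c`. -/
theorem exists_mixDiff_ne_zero {μstar μ : Params} (hs : μstar 0 ≤ μstar 1) (hm : μ 0 ≤ μ 1)
    (hne : μ 0 ≠ μstar 0 ∨ μ 1 ≠ μstar 1) : ∃ x, mixDiff μstar μ x ≠ 0 := by
  have key : ∀ a b c d : ℝ, a ≤ b → c ≤ d → a ≤ c → (a ≠ c ∨ b ≠ d) → ∃ x,
      stdGauss (x - a) + stdGauss (x - b) - stdGauss (x - c) - stdGauss (x - d) ≠ 0 := by
    intro a b c d hab hcd hac hne
    rcases le_or_gt b d with hbd | hbd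
    · refine ⟨a - 1, ne_of_gt ?_⟩
      rcases hne with h | h
      · have h1 : stdGauss (a - 1 - c) < stdGauss (a - 1 - a) :=
          stdGauss_lt_of_sq_lt (by have := lt_of_le_of_ne hac h; nlinarith)
        have h2 : stdGauss (a - 1 - d) ≤ stdGauss (a - 1 - b) :=
          stdGauss_le_of_sq_le (by nlinarith)
        linarith
      · have h1 : stdGauss (a - 1 - c) ≤ stdGauss (a - 1 - a) :=
          stdGauss_le_of_sq_le (by nlinarith)
        have h2 : stdGauss (a - 1 - d) < stdGauss (a - 1 - b) :=
          stdGauss_lt_of_sq_lt (by have := lt_of_le_of_ne hbd h; nlinarith)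
        linarith
    · refine ⟨c, ne_of_lt ?_⟩
      have h1 : stdGauss (c - a) ≤ stdGauss (c - c) := stdGauss_le_of_sq_le (by nlinarith)
      have h2 : stdGauss (c - b) < stdGauss (c - d) := stdGauss_lt_of_sq_lt (by nlinarith)
      linarith
  rcases le_total (μ 0) (μstar 0) with h | h
  · obtain ⟨x, hx⟩ := key _ _ _ _ hm hs h hne
    exact ⟨x, by rw [mixDiff_eq]; exact mul_ne_zero (by norm_num) hx⟩
  · obtain ⟨x, hx⟩ := key _ _ _ _ hs hm h (hne.imp Ne.symm Ne.symm)
    refine ⟨x, ?_⟩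
    rw [mixDiff_eq]
    intro h0
    apply hx
    linarith

theorem hasGradientAt_tvLoss_of_ne {μstar μ : Params} (hs : μstar 0 ≤ μstar 1) (hm : μ 0 ≤ μ 1)
    (hne : μ 0 ≠ μstar 0 ∨ μ 1 ≠ μstar 1) :
    HasGradientAt (tvLoss μstar) !₂[gradComp μstar μ 0, gradComp μstar μ 1] μ :=
  hasGradientAt_tvLoss (ae_mixDiff_ne_zero (exists_mixDiff_ne_zero hs hm hne).choose_spec)


/-! ### Gradient bound when both means are shifted the same way. -/

theorem integral_eq_Iic_add_Ioc_add_Ioi {f : ℝ → ℝ} (hf : Integrable f) {a b : ℝ} (hab : a ≤ b) :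
    ∫ x, f x = (∫ x in Iic a, f x) + (∫ x in Ioc a b, f x) + ∫ x in Ioi b, f x := by
  rw [← integral_add_compl (measurableSet_Iic (a := b)) hf, compl_Iic, ← Iic_union_Ioc_eq_Iic hab,
    setIntegral_union (Iic_disjoint_Ioc le_rfl) measurableSet_Ioc hf.integrableOn hf.integrableOn]

/-- The two outer pieces give `-φ(0)` and `-φ(b - a)`. Between them the moment is nonnegative, so
the unknown sign gains at most `φ(0) - φ(b - a)`. -/
theorem integral_mul_stdGaussMoment_le {s : ℝ → ℝ} {a b : ℝ} (hab : a ≤ b)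
    (hint : Integrable fun x => s x * stdGaussMoment (x - a)) (hs : ∀ x, |s x| ≤ 1)
    (h1 : ∀ x ≤ a, s x = 1) (h2 : ∀ x, b < x → s x = -1) :
    ∫ x, s x * stdGaussMoment (x - a) ≤ -2 * stdGauss (b - a) := by
  have hg := integrable_stdGaussMoment.comp_sub_right a
  rw [integral_eq_Iic_add_Ioc_add_Ioi hint hab]
  have e1 : ∫ x in Iic a, s x * stdGaussMoment (x - a) = -stdGauss (a - a) := by
    rw [← integral_Iic_stdGaussMoment]
    exact setIntegral_congr_fun measurableSet_Iic fun x hx => by simp [h1 x hx]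
  have e2 : ∫ x in Ioc a b, s x * stdGaussMoment (x - a) ≤ stdGauss (a - a) - stdGauss (b - a) := by
    rw [← integral_Ioc_stdGaussMoment a hab]
    refine setIntegral_mono_on hint.integrableOn hg.integrableOn measurableSet_Ioc fun x hx => ?_
    have h0 : 0 ≤ stdGaussMoment (x - a) :=
      mul_nonneg (by linarith [hx.1]) (stdGauss_pos _).le
    nlinarith [(abs_le.1 (hs x)).2]
  have e3 : ∫ x in Ioi b, s x * stdGaussMoment (x - a) = -stdGauss (b - a) := by
    rw [← integral_Ioi_stdGaussMoment, ← integral_neg]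
    exact setIntegral_congr_fun measurableSet_Ioi fun x hx => by simp [h2 x hx]
  linarith

theorem le_integral_mul_stdGaussMoment {s : ℝ → ℝ} {a b : ℝ} (hab : a ≤ b)
    (hint : Integrable fun x => s x * stdGaussMoment (x - b)) (hs : ∀ x, |s x| ≤ 1)
    (h1 : ∀ x ≤ a, s x = -1) (h2 : ∀ x, b < x → s x = 1) :
    2 * stdGauss (a - b) ≤ ∫ x, s x * stdGaussMoment (x - b) := by
  have hg := integrable_stdGaussMoment.comp_sub_right b
  rw [integral_eq_Iic_add_Ioc_add_Ioi hint hab]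
  have e1 : ∫ x in Iic a, s x * stdGaussMoment (x - b) = stdGauss (a - b) := by
    rw [← neg_neg (stdGauss (a - b)), ← integral_Iic_stdGaussMoment, ← integral_neg]
    exact setIntegral_congr_fun measurableSet_Iic fun x hx => by simp [h1 x hx]
  have e2 : stdGauss (a - b) - stdGauss (b - b) ≤ ∫ x in Ioc a b, s x * stdGaussMoment (x - b) := by
    rw [← integral_Ioc_stdGaussMoment b hab]
    refine setIntegral_mono_on hg.integrableOn hint.integrableOn measurableSet_Ioc fun x hx => ?_
    have h0 : stdGaussMoment (x - b) ≤ 0 :=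
      mul_nonpos_of_nonpos_of_nonneg (by linarith [hx.2]) (stdGauss_pos _).le
    nlinarith [(abs_le.1 (hs x)).2]
  have e3 : ∫ x in Ioi b, s x * stdGaussMoment (x - b) = stdGauss (b - b) := by
    rw [← integral_Ioi_stdGaussMoment]
    exact setIntegral_congr_fun measurableSet_Ioi fun x hx => by simp [h2 x hx]
  linarith

theorem gradComp_zero_le {μstar μ : Params} (hs : μstar 0 ≤ μstar 1) (hm : μ 0 ≤ μ 1)
    (h0 : μ 0 < μstar 0) (h1 : μ 1 < μstar 1) :
    gradComp μstar μ 0 ≤ -(1 / 2) * stdGauss (μstar 1 - μ 0) := by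
  have := integral_mul_stdGaussMoment_le (s := fun x => SignType.sign (mixDiff μstar μ x))
    (h0.le.trans hs) (integrable_sign_mul_stdGaussMoment μstar μ (μ 0))
    (fun x => abs_sign_le_one _)
    (fun x hx => by
      have e1 : stdGauss (x - μstar 0) < stdGauss (x - μ 0) :=
        stdGauss_lt_of_sq_lt (by nlinarith)
      have e2 : stdGauss (x - μstar 1) < stdGauss (x - μ 1) :=
        stdGauss_lt_of_sq_lt (by nlinarith)
      have : 0 < mixDiff μstar μ x := by rw [mixDiff_eq]; linarith
      simp [this])
    (fun x hx => by
      have e1 : stdGauss (x - μ 0) < stdGauss (x - μstar 0) :=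
        stdGauss_lt_of_sq_lt (by nlinarith)
      have e2 : stdGauss (x - μ 1) < stdGauss (x - μstar 1) :=
        stdGauss_lt_of_sq_lt (by nlinarith)
      have : mixDiff μstar μ x < 0 := by rw [mixDiff_eq]; linarith
      simp [this])
  unfold gradComp
  linarith

theorem le_gradComp_one {μstar μ : Params} (hs : μstar 0 ≤ μstar 1) (hm : μ 0 ≤ μ 1)
    (h0 : μstar 0 < μ 0) (h1 : μstar 1 < μ 1) :
    1 / 2 * stdGauss (μstar 0 - μ 1) ≤ gradComp μstar μ 1 := by
  have := le_integral_mul_stdGaussMoment (s := fun x => SignType.sign (mixDiff μstar μ x))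
    (h0.le.trans hm) (integrable_sign_mul_stdGaussMoment μstar μ (μ 1))
    (fun x => abs_sign_le_one _)
    (fun x hx => by
      have e1 : stdGauss (x - μ 0) < stdGauss (x - μstar 0) :=
        stdGauss_lt_of_sq_lt (by nlinarith)
      have e2 : stdGauss (x - μ 1) < stdGauss (x - μstar 1) :=
        stdGauss_lt_of_sq_lt (by nlinarith)
      have : mixDiff μstar μ x < 0 := by rw [mixDiff_eq]; linarith
      simp [this])
    (fun x hx => by
      have e1 : stdGauss (x - μstar 0) < stdGauss (x - μ 0) :=
        stdGauss_lt_of_sq_lt (by nlinarith)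
      have e2 : stdGauss (x - μstar 1) < stdGauss (x - μ 1) :=
        stdGauss_lt_of_sq_lt (by nlinarith)
      have : 0 < mixDiff μstar μ x := by rw [mixDiff_eq]; linarith
      simp [this])
  unfold gradComp
  linarith

/-! ### Gradient bound for nested pairs of means. -/

/-- Difference of two pairs of Gaussian bumps with centres `o₁, o₂` and `i₁, i₂`. -/
noncomputable def bumpDiff (o₁ o₂ i₁ i₂ x : ℝ) : ℝ :=
  stdGauss (x - o₁) + stdGauss (x - o₂) - stdGauss (x - i₁) - stdGauss (x - i₂)

theorem bumpDiff_neg (o₁ o₂ i₁ i₂ x : ℝ) :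
    bumpDiff o₁ o₂ i₁ i₂ (-x) = bumpDiff (-o₂) (-o₁) (-i₂) (-i₁) x := by
  have h : ∀ a, stdGauss (-x - a) = stdGauss (x - -a) := fun a => by
    rw [← stdGauss_neg]; congr 1; ring
  simp only [bumpDiff, h]; ring

theorem stdGauss_sub_eq_mul_exp (m a x : ℝ) :
    stdGauss (x - m) = stdGauss (x - a) * Real.exp ((m - a) * (x - (m + a) / 2)) := by
  rw [stdGauss, stdGauss, mul_assoc, ← Real.exp_add]
  congr 2; ring

theorem bumpDiff_neg_of_mem_Icc {o₁ o₂ i₁ i₂ x : ℝ} (h1 : o₁ < i₁) (h3 : i₂ < o₂)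
    (hx : x ∈ Icc i₁ i₂) : bumpDiff o₁ o₂ i₁ i₂ x < 0 := by
  have e1 : stdGauss (x - o₁) < stdGauss (x - i₁) := stdGauss_lt_of_sq_lt (by nlinarith [hx.1])
  have e2 : stdGauss (x - o₂) < stdGauss (x - i₂) := stdGauss_lt_of_sq_lt (by nlinarith [hx.2])
  unfold bumpDiff; linarith

theorem bddAbove_bumpDiff_neg {o₁ o₂ i₁ i₂ : ℝ} (h2 : i₁ < i₂) (h3 : i₂ < o₂) :
    BddAbove {x | bumpDiff o₁ o₂ i₁ i₂ x < 0} := by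
  -- Beyond this point the bump at `o₂` is at least twice the one at `i₂`, so it outweighs both
  -- inner bumps.
  refine ⟨(o₂ + i₂) / 2 + 1 / (o₂ - i₂), fun x hx => ?_⟩
  by_contra! h
  have hd : 0 < o₂ - i₂ := by linarith
  have hd' : 0 < 1 / (o₂ - i₂) := by positivity
  have e1 := stdGauss_sub_eq_mul_exp o₂ i₂ x
  have e2 : stdGauss (x - i₁) ≤ stdGauss (x - i₂) := stdGauss_le_of_sq_le (by nlinarith)
  have e3 : 1 ≤ (o₂ - i₂) * (x - (o₂ + i₂) / 2) := by
    calc 1 = (o₂ - i₂) * (1 / (o₂ - i₂)) := by field_simp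
      _ ≤ _ := by gcongr; linarith
  have e4 : 2 ≤ Real.exp ((o₂ - i₂) * (x - (o₂ + i₂) / 2)) := by
    linarith [Real.add_one_le_exp ((o₂ - i₂) * (x - (o₂ + i₂) / 2))]
  have p1 := stdGauss_pos (x - o₁)
  have p2 := stdGauss_pos (x - i₂)
  simp only [mem_ofPred_eq, bumpDiff] at hx
  nlinarith

theorem bddBelow_bumpDiff_neg {o₁ o₂ i₁ i₂ : ℝ} (h1 : o₁ < i₁) (h2 : i₁ < i₂) :
    BddBelow {x | bumpDiff o₁ o₂ i₁ i₂ x < 0} := by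
  obtain ⟨b, hb⟩ := bddAbove_bumpDiff_neg (o₁ := -o₂) (neg_lt_neg h2) (neg_lt_neg h1)
  refine ⟨-b, fun x hx => ?_⟩
  have : -x ≤ b := hb (by
    simp only [mem_ofPred_eq] at hx ⊢
    rw [← bumpDiff_neg, neg_neg]; exact hx)
  linarith

/-- A Rolle argument: dividing by the bump at `i₁` gives `W`, and dividing `W'` by its `i₂`
exponential gives the monotone `V`. Thus `W` cannot rise and later fall, as it would between two
negative values separated by a nonnegative one. -/
theorem ordConnected_bumpDiff_neg {o₁ o₂ i₁ i₂ : ℝ} (h1 : o₁ < i₁) (h2 : i₁ < i₂) (h3 : i₂ < o₂) :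
    OrdConnected {x | bumpDiff o₁ o₂ i₁ i₂ x < 0} := by
  set W : ℝ → ℝ := fun x => Real.exp ((o₁ - i₁) * (x - (o₁ + i₁) / 2)) +
    Real.exp ((o₂ - i₁) * (x - (o₂ + i₁) / 2)) - 1 - Real.exp ((i₂ - i₁) * (x - (i₂ + i₁) / 2))
    with hW
  have hfac : ∀ x, bumpDiff o₁ o₂ i₁ i₂ x = stdGauss (x - i₁) * W x := by
    intro x
    simp only [bumpDiff, hW]
    rw [stdGauss_sub_eq_mul_exp o₁ i₁ x, stdGauss_sub_eq_mul_exp o₂ i₁ x,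
      stdGauss_sub_eq_mul_exp i₂ i₁ x]
    ring
  have hneg : ∀ x, bumpDiff o₁ o₂ i₁ i₂ x < 0 ↔ W x < 0 := fun x => by
    rw [hfac]
    have hp := stdGauss_pos (x - i₁)
    exact ⟨fun h => neg_of_mul_neg_right h hp.le, fun h => mul_neg_of_pos_of_neg hp h⟩
  set V : ℝ → ℝ := fun x => (o₁ - i₁) * Real.exp ((o₁ - i₁) * (x - (o₁ + i₁) / 2)
      - (i₂ - i₁) * (x - (i₂ + i₁) / 2)) +
    (o₂ - i₁) * Real.exp ((o₂ - i₁) * (x - (o₂ + i₁) / 2) - (i₂ - i₁) * (x - (i₂ + i₁) / 2))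
    - (i₂ - i₁) with hV
  have hderiv : ∀ x, HasDerivAt W (V x * Real.exp ((i₂ - i₁) * (x - (i₂ + i₁) / 2))) x := by
    intro x
    have hE : ∀ a b : ℝ, HasDerivAt (fun x => Real.exp (a * (x - b)))
        (a * Real.exp (a * (x - b))) x := by
      intro a b
      have := (((hasDerivAt_id x).sub_const b).const_mul a).exp
      exact this.congr_deriv (by simp; ring)
    refine ((((hE _ _).add (hE _ _)).sub_const 1).sub (hE _ _)).congr_deriv ?_
    simp only [hV, Real.exp_sub]
    field_simp
  have hmono : Monotone V := by
    intro x y hxy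
    simp only [hV]
    have a1 : Real.exp ((o₁ - i₁) * (y - (o₁ + i₁) / 2) - (i₂ - i₁) * (y - (i₂ + i₁) / 2)) ≤
        Real.exp ((o₁ - i₁) * (x - (o₁ + i₁) / 2) - (i₂ - i₁) * (x - (i₂ + i₁) / 2)) := by
      apply Real.exp_le_exp.2; nlinarith
    have a2 : Real.exp ((o₂ - i₁) * (x - (o₂ + i₁) / 2) - (i₂ - i₁) * (x - (i₂ + i₁) / 2)) ≤
        Real.exp ((o₂ - i₁) * (y - (o₂ + i₁) / 2) - (i₂ - i₁) * (y - (i₂ + i₁) / 2)) := by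
      apply Real.exp_le_exp.2; nlinarith
    nlinarith
  refine ⟨fun x hx z hz y hy => ?_⟩
  simp only [mem_ofPred_eq, hneg] at hx hz ⊢
  by_contra! hyW
  have hxy : x < y := lt_of_le_of_ne hy.1 (by rintro rfl; linarith)
  have hyz : y < z := lt_of_le_of_ne hy.2 (by rintro rfl; linarith)
  have hc : Continuous W := continuous_iff_continuousAt.2 fun x => (hderiv x).continuousAt
  obtain ⟨p, hp, hp'⟩ := exists_hasDerivAt_eq_slope W _ hxy hc.continuousOn fun x _ => hderiv x
  obtain ⟨q, hq, hq'⟩ := exists_hasDerivAt_eq_slope W _ hyz hc.continuousOn fun x _ => hderiv x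
  have hVp : 0 < V p := by
    have : 0 < (W y - W x) / (y - x) := div_pos (by linarith) (by linarith)
    rw [← hp'] at this
    exact pos_of_mul_pos_left this (Real.exp_pos _).le
  have hVq : V q < 0 := by
    have : (W z - W y) / (z - y) < 0 := div_neg_of_neg_of_pos (by linarith) (by linarith)
    rw [← hq'] at this
    exact neg_of_mul_neg_left this (Real.exp_pos _).le
  linarith [hmono (hp.2.trans hq.1).le]

theorem strictMonoOn_exp_neg_sq_mul_cosh {C : ℝ} (hC : 1 ≤ C) :
    StrictMonoOn (fun s => Real.exp (-s ^ 2 / 2) * Real.cosh (4 * C * s)) (Icc 0 (2 * C)) := by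
  have hd : ∀ s, HasDerivAt (fun s => Real.exp (-s ^ 2 / 2) * Real.cosh (4 * C * s))
      (Real.exp (-s ^ 2 / 2) * (4 * C * Real.sinh (4 * C * s) - s * Real.cosh (4 * C * s))) s := by
    intro s
    have h1 : HasDerivAt (fun s : ℝ => -s ^ 2 / 2) (-s) s :=
      (((hasDerivAt_pow 2 s).neg).div_const 2).congr_deriv (by push_cast; ring)
    have h2 : HasDerivAt (fun s : ℝ => 4 * C * s) (4 * C) s := by
      simpa using (hasDerivAt_id s).const_mul (4 * C)
    exact (h1.exp.mul h2.cosh).congr_deriv (by ring)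
  refine strictMonoOn_of_deriv_pos (convex_Icc _ _)
    (fun s _ => (hd s).continuousAt.continuousWithinAt) fun s hs => ?_
  rw [interior_Icc] at hs
  rw [(hd s).deriv]
  refine mul_pos (Real.exp_pos _) ?_
  obtain ⟨hs0, hs1⟩ := hs
  -- Positivity of the derivative amounts to `(4C - s) e^{8Cs} > 4C + s`, for which `e^y ≥ 1 + y`
  -- suffices when `s ≤ 2C`.
  have e1 : 2 * (4 * C * s) + 1 ≤ Real.exp (4 * C * s) * Real.exp (4 * C * s) := by
    rw [← Real.exp_add, ← two_mul]; exact Real.add_one_le_exp _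
  have e2 : Real.exp (-(4 * C * s)) * Real.exp (4 * C * s) = 1 := by
    rw [← Real.exp_add]; simp
  have hp := Real.exp_pos (-(4 * C * s))
  have hp2 := Real.exp_pos (4 * C * s)
  rw [Real.sinh_eq, Real.cosh_eq]
  have e3 : 0 < (4 * C - s) * (2 * (4 * C * s) + 1) - (4 * C + s) := by
    nlinarith [mul_pos hs0 (show 0 < C by linarith), mul_nonneg hs0.le (show 0 ≤ C * C - 1 by nlinarith)]
  have e4 : 0 < (4 * C - s) * (Real.exp (4 * C * s) * Real.exp (4 * C * s)) - (4 * C + s) := by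
    have : 0 ≤ 4 * C - s := by linarith
    nlinarith
  have e5 : 0 < ((4 * C - s) * Real.exp (4 * C * s) - (4 * C + s) * Real.exp (-(4 * C * s))) *
      Real.exp (4 * C * s) := by
    nlinarith
  have := pos_of_mul_pos_left e5 hp2.le
  linarith

theorem stdGauss_add_add_stdGauss_sub_lt {C u v : ℝ} (hC : 1 ≤ C) (huv : |u| < |v|)
    (hv : |v| ≤ 2 * C) : stdGauss (u + 4 * C) + stdGauss (u - 4 * C) <
      stdGauss (v + 4 * C) + stdGauss (v - 4 * C) := by
  have h : ∀ s : ℝ, stdGauss (s + 4 * C) + stdGauss (s - 4 * C) =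
      (√(2 * Real.pi))⁻¹ * (2 * Real.exp (-(4 * C) ^ 2 / 2)) *
        (Real.exp (-|s| ^ 2 / 2) * Real.cosh (4 * C * |s|)) := by
    intro s
    have hc : Real.cosh (4 * C * |s|) = Real.cosh (4 * C * s) := by
      rw [← Real.cosh_abs (4 * C * s), abs_mul, abs_of_pos (show 0 < 4 * C by linarith)]
    rw [hc, sq_abs, Real.cosh_eq, stdGauss, stdGauss,
      show -(s + 4 * C) ^ 2 / 2 = -(4 * C) ^ 2 / 2 + -s ^ 2 / 2 + -(4 * C * s) by ring,
      show -(s - 4 * C) ^ 2 / 2 = -(4 * C) ^ 2 / 2 + -s ^ 2 / 2 + 4 * C * s by ring]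
    simp only [Real.exp_add]
    ring
  rw [h, h]
  have := strictMonoOn_exp_neg_sq_mul_cosh hC ⟨abs_nonneg u, huv.le.trans hv⟩ ⟨abs_nonneg v, hv⟩ huv
  exact mul_lt_mul_of_pos_left this (by positivity)

/-- Sampled at `i₁ ± 4C`, a bump contributes a total that grows with the distance of its centre from
`i₁`, and the outer centres are farther away. Hence the difference is not negative at both points,
which keeps one end of its negative interval within `4C` of `i₁`. -/
theorem bumpDiff_sub_add_bumpDiff_add_pos {C o₁ o₂ i₁ i₂ : ℝ} (hC : 1 ≤ C) (h1 : o₁ < i₁)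
    (h2 : i₁ < i₂) (h3 : i₂ < o₂) (ho₁ : -C ≤ o₁) (ho₂ : o₂ ≤ C) :
    0 < bumpDiff o₁ o₂ i₁ i₂ (i₁ - 4 * C) + bumpDiff o₁ o₂ i₁ i₂ (i₁ + 4 * C) := by
  have a1 := stdGauss_add_add_stdGauss_sub_lt (u := i₁ - i₁) (v := i₁ - o₁) hC
    (by rw [sub_self, abs_zero, abs_of_pos (by linarith)]; linarith)
    (by rw [abs_of_pos (by linarith)]; linarith)
  have a2 := stdGauss_add_add_stdGauss_sub_lt (u := i₁ - i₂) (v := i₁ - o₂) hC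
    (by rw [abs_of_neg (by linarith), abs_of_neg (by linarith)]; linarith)
    (by rw [abs_of_neg (by linarith)]; linarith)
  have e : ∀ m, i₁ - 4 * C - m = i₁ - m - 4 * C ∧ i₁ + 4 * C - m = i₁ - m + 4 * C :=
    fun m => ⟨by ring, by ring⟩
  simp only [bumpDiff, (e _).1, (e _).2]
  linarith

theorem exists_bumpDiff_neg_interval {C o₁ o₂ i₁ i₂ : ℝ} (hC : 1 ≤ C) (h1 : o₁ < i₁)
    (h2 : i₁ < i₂) (h3 : i₂ < o₂) (ho₁ : -C ≤ o₁) (ho₂ : o₂ ≤ C) :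
    ∃ r₁ r₂, r₁ ≤ i₁ ∧ i₂ ≤ r₂ ∧ (-(5 * C) ≤ r₁ ∨ r₂ ≤ 5 * C) ∧
      (∀ x ∈ Ioo r₁ r₂, bumpDiff o₁ o₂ i₁ i₂ x < 0) ∧
      ∀ x, x ∉ Icc r₁ r₂ → 0 ≤ bumpDiff o₁ o₂ i₁ i₂ x := by
  set N := {x | bumpDiff o₁ o₂ i₁ i₂ x < 0} with hN
  have ha : BddAbove N := bddAbove_bumpDiff_neg h2 h3
  have hb : BddBelow N := bddBelow_bumpDiff_neg h1 h2
  have hord : OrdConnected N := ordConnected_bumpDiff_neg h1 h2 h3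
  have m1 : i₁ ∈ N := bumpDiff_neg_of_mem_Icc h1 h3 ⟨le_rfl, h2.le⟩
  have m2 : i₂ ∈ N := bumpDiff_neg_of_mem_Icc h1 h3 ⟨h2.le, le_rfl⟩
  refine ⟨sInf N, sSup N, csInf_le hb m1, le_csSup ha m2, ?_,
    fun x hx => ?_, fun x hx => ?_⟩
  · have hpos := bumpDiff_sub_add_bumpDiff_add_pos hC h1 h2 h3 ho₁ ho₂
    by_cases hl : 0 < bumpDiff o₁ o₂ i₁ i₂ (i₁ - 4 * C)
    · left
      refine le_csInf ⟨_, m1⟩ fun y hy => ?_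
      by_contra! hlt
      have : i₁ - 4 * C ∈ N := hord.out hy m1 ⟨by linarith, by linarith⟩
      exact absurd this (by simp only [hN, mem_ofPred_eq]; linarith)
    · right
      refine csSup_le ⟨_, m1⟩ fun y hy => ?_
      by_contra! hlt
      have : i₁ + 4 * C ∈ N := hord.out m1 hy ⟨by linarith, by linarith⟩
      simp only [hN, mem_ofPred_eq] at this
      linarith
  · obtain ⟨y, hy, hyx⟩ := exists_lt_of_csInf_lt ⟨_, m1⟩ hx.1
    obtain ⟨z, hz, hxz⟩ := exists_lt_of_lt_csSup ⟨_, m1⟩ hx.2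
    exact hord.out hy hz ⟨hyx.le, hxz.le⟩
  · by_contra! h
    exact hx ⟨csInf_le hb h, le_csSup ha h⟩

/-- Almost everywhere `s` is 1 minus twice the indicator of the interval, and the moment integrates
to zero over the line. -/
theorem integral_mul_stdGaussMoment_of_interval {s : ℝ → ℝ} {r₁ r₂ m : ℝ} (hr : r₁ ≤ r₂)
    (hs1 : ∀ᵐ x : ℝ, x ∈ Ioo r₁ r₂ → s x = -1) (hs2 : ∀ᵐ x : ℝ, x ∉ Icc r₁ r₂ → s x = 1) :
    ∫ x, s x * stdGaussMoment (x - m) = 2 * (stdGauss (r₂ - m) - stdGauss (r₁ - m)) := by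
  have hne : ∀ r : ℝ, ∀ᵐ x : ℝ, x ≠ r := fun r => by
    simp [ae_iff, measure_singleton]
  have hg := integrable_stdGaussMoment.comp_sub_right m
  have e : ∀ᵐ x : ℝ, s x * stdGaussMoment (x - m) = stdGaussMoment (x - m) -
      2 * (Ioc r₁ r₂).indicator (fun x => stdGaussMoment (x - m)) x := by
    filter_upwards [hs1, hs2, hne r₁, hne r₂] with x h1 h2 h3 h4
    by_cases hx : x ∈ Ioo r₁ r₂
    · rw [h1 hx, indicator_of_mem (Ioo_subset_Ioc_self hx)]; ring
    · have hx' : x ∉ Icc r₁ r₂ := fun hc =>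
        hx ⟨lt_of_le_of_ne hc.1 h3.symm, lt_of_le_of_ne hc.2 h4⟩
      rw [h2 hx', indicator_of_notMem fun hc => hx' (Ioc_subset_Icc_self hc)]; ring
  rw [integral_congr_ae e, integral_sub hg ((hg.indicator measurableSet_Ioc).const_mul 2),
    integral_const_mul, integral_indicator measurableSet_Ioc, integral_Ioc_stdGaussMoment m hr,
    integral_eq_Iic_add_Ioc_add_Ioi hg le_rfl (a := r₁), integral_Iic_stdGaussMoment,
    integral_Ioi_stdGaussMoment]
  simp
  ring

theorem le_stdGauss_sub_stdGauss {C δ u w : ℝ} (hδ : 0 ≤ δ) (hδ1 : δ ≤ 1)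
    (hu : |u| ≤ 6 * C) (hw : u ^ 2 + δ ^ 2 ≤ w ^ 2) :
    1 / 12 * (δ ^ 2 * Real.exp (-(18 * C ^ 2))) ≤ stdGauss u - stdGauss w := by
  have hu2 : u ^ 2 ≤ 36 * C ^ 2 := by
    rw [← sq_abs]; nlinarith [abs_nonneg u]
  have h1 : stdGauss w ≤ stdGauss u * Real.exp (-(δ ^ 2 / 2)) := by
    rw [stdGauss, stdGauss, mul_assoc, ← Real.exp_add]
    gcongr
    linarith
  have h2 : Real.exp (-(δ ^ 2 / 2)) ≤ 1 - δ ^ 2 / 4 := by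
    have h3 := Real.add_one_le_exp (δ ^ 2 / 2)
    have hp := Real.exp_pos (-(δ ^ 2 / 2))
    have h4 : Real.exp (-(δ ^ 2 / 2)) * Real.exp (δ ^ 2 / 2) = 1 := by
      rw [← Real.exp_add]; simp
    have h5 : δ ^ 2 ≤ 1 := by nlinarith
    have h6 : Real.exp (-(δ ^ 2 / 2)) * (1 + δ ^ 2 / 2) ≤ 1 := by nlinarith
    have h7 : 1 ≤ (1 - δ ^ 2 / 4) * (1 + δ ^ 2 / 2) := by nlinarith [sq_nonneg δ]
    exact le_of_mul_le_mul_right (h6.trans h7) (by positivity)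
  have h3 : 1 / 3 * Real.exp (-(18 * C ^ 2)) ≤ stdGauss u := by
    refine le_trans ?_ (third_mul_le_stdGauss u)
    gcongr
    linarith
  have hp := stdGauss_pos u
  calc 1 / 12 * (δ ^ 2 * Real.exp (-(18 * C ^ 2)))
      = 1 / 3 * Real.exp (-(18 * C ^ 2)) * (δ ^ 2 / 4) := by ring
    _ ≤ stdGauss u * (δ ^ 2 / 4) := by gcongr
    _ ≤ _ := by nlinarith

/-- The midpoint of `r₁, r₂` is at least `δ/2` away from one of the two means. For that mean the
squared distances to `r₁` and `r₂` differ by at least `δ²`. -/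
theorem exists_le_abs_stdGauss_sub {C δ r₁ r₂ : ℝ} {m : Fin 2 → ℝ} (hδ : 0 < δ) (hδ1 : δ ≤ 1)
    (hr : δ ≤ r₂ - r₁) (hm : δ ≤ m 1 - m 0) (hmC : ∀ i, |m i| ≤ C)
    (hnear : |r₁| ≤ 5 * C ∨ |r₂| ≤ 5 * C) :
    ∃ i, 1 / 12 * (δ ^ 2 * Real.exp (-(18 * C ^ 2))) ≤
      |stdGauss (r₂ - m i) - stdGauss (r₁ - m i)| := by
  obtain ⟨i, hi⟩ : ∃ i, δ ≤ |r₁ + r₂ - 2 * m i| := by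
    by_contra! h
    have h0 := abs_lt.1 (h 0)
    have h1 := abs_lt.1 (h 1)
    linarith
  refine ⟨i, ?_⟩
  have hd : δ ^ 2 ≤ |(r₂ - m i) ^ 2 - (r₁ - m i) ^ 2| := by
    rw [show (r₂ - m i) ^ 2 - (r₁ - m i) ^ 2 = (r₂ - r₁) * (r₁ + r₂ - 2 * m i) by ring, abs_mul,
      abs_of_pos (by linarith : 0 < r₂ - r₁), sq]
    exact mul_le_mul hr hi hδ.le (by linarith)
  have hmin : |r₁ - m i| ≤ 6 * C ∨ |r₂ - m i| ≤ 6 * C := by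
    refine hnear.imp (fun h => ?_) (fun h => ?_) <;>
    · refine (abs_sub _ _).trans ?_
      linarith [hmC i]
  rcases le_total ((r₁ - m i) ^ 2) ((r₂ - m i) ^ 2) with h | h
  · rw [abs_of_nonneg (sub_nonneg.2 h)] at hd
    have hu : |r₁ - m i| ≤ 6 * C := hmin.elim id fun h' => (sq_le_sq.1 h).trans h'
    refine (le_stdGauss_sub_stdGauss (w := r₂ - m i) hδ.le hδ1 hu (by linarith)).trans ?_
    rw [abs_sub_comm]
    exact le_abs_self _
  · rw [abs_of_nonpos (sub_nonpos.2 h)] at hd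
    have hu : |r₂ - m i| ≤ 6 * C := hmin.elim (fun h' => (sq_le_sq.1 h).trans h') id
    refine (le_stdGauss_sub_stdGauss (w := r₁ - m i) hδ.le hδ1 hu (by linarith)).trans ?_
    exact le_abs_self _

theorem exists_le_abs_gradComp_of_nested {μstar μ : Params} {C δ o₁ o₂ i₁ i₂ σ : ℝ} (hC : 1 ≤ C)
    (hδ : 0 < δ) (hδ1 : δ ≤ 1) (h1 : o₁ < i₁) (h2 : δ ≤ i₂ - i₁) (h3 : i₂ < o₂) (ho₁ : -C ≤ o₁)
    (ho₂ : o₂ ≤ C) (hσ : σ = 1 ∨ σ = -1) (hm : δ ≤ μ 1 - μ 0) (hmC : ∀ i, |μ i| ≤ C)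
    (hD : ∀ x, mixDiff μstar μ x = σ * (1 / 2 * bumpDiff o₁ o₂ i₁ i₂ x)) :
    ∃ i, 1 / 24 * (δ ^ 2 * Real.exp (-(18 * C ^ 2))) ≤ |gradComp μstar μ i| := by
  obtain ⟨r₁, r₂, hr1, hr2, hnear, hneg, hpos⟩ :=
    exists_bumpDiff_neg_interval hC h1 (by linarith) h3 ho₁ ho₂
  have hσ0 : σ ≠ 0 := by rcases hσ with rfl | rfl <;> norm_num
  have hnz : ∀ᵐ x : ℝ, mixDiff μstar μ x ≠ 0 := by
    refine ae_mixDiff_ne_zero (x₀ := i₁) ?_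
    rw [hD]
    have := bumpDiff_neg_of_mem_Icc h1 h3 (x := i₁) ⟨le_rfl, by linarith⟩
    exact mul_ne_zero hσ0 (mul_ne_zero (by norm_num) this.ne)
  have hsign : ∀ x, ((SignType.sign (mixDiff μstar μ x) : SignType) : ℝ) =
      σ * ((SignType.sign (bumpDiff o₁ o₂ i₁ i₂ x) : SignType) : ℝ) := by
    intro x
    rw [hD, sign_mul, sign_mul]
    rcases hσ with rfl | rfl <;> simp [sign_pos]
  have hG : ∀ i, gradComp μstar μ i =
      σ * (1 / 2 * (stdGauss (r₂ - μ i) - stdGauss (r₁ - μ i))) := by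
    intro i
    have hI := integral_mul_stdGaussMoment_of_interval (m := μ i) (r₁ := r₁) (r₂ := r₂)
      (s := fun x => ((SignType.sign (bumpDiff o₁ o₂ i₁ i₂ x) : SignType) : ℝ)) (by linarith)
      (ae_of_all _ fun x hx => by simp [hneg x hx])
      (by
        filter_upwards [hnz] with x hx hx'
        have hb : bumpDiff o₁ o₂ i₁ i₂ x ≠ 0 := fun h0 => hx (by rw [hD, h0]; ring)
        have : 0 < bumpDiff o₁ o₂ i₁ i₂ x := lt_of_le_of_ne (hpos x hx') hb.symm
        simp [this])
    simp only [gradComp, hsign, mul_assoc]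
    rw [integral_const_mul, hI]
    ring
  obtain ⟨i, hi⟩ := exists_le_abs_stdGauss_sub (m := fun i => μ i) hδ hδ1
    (by linarith : δ ≤ r₂ - r₁) hm hmC
    (hnear.imp (fun h => abs_le.2 ⟨h, by linarith⟩) (fun h => abs_le.2 ⟨by linarith, h⟩))
  refine ⟨i, ?_⟩
  rw [hG, abs_mul, abs_mul]
  have : |σ| = 1 := by rcases hσ with rfl | rfl <;> simp
  rw [this, abs_of_pos (by norm_num : (0 : ℝ) < 1 / 2)]
  linarith

theorem abs_le_norm_pair (a b : ℝ) :
    |a| ≤ ‖(!₂[a, b] : Params)‖ ∧ |b| ≤ ‖(!₂[a, b] : Params)‖ := by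
  constructor
  · simpa using PiLp.norm_apply_le (!₂[a, b] : Params) 0
  · simpa using PiLp.norm_apply_le (!₂[a, b] : Params) 1

/-- The exponent 18 is `6²/2`: the relevant Gaussian values are taken at distance at most `6C`. The
spare powers of `δ` and `1/C` only weaken the bound. -/
theorem isGradBound_explicit : IsGradBound (1 / 24) 18 := by
  intro C γ δ hC hγ hδγ hδ μstar μ hs hm hne hsC hmC hsγ hmδ
  have hg := hasGradientAt_tvLoss_of_ne hs hm (Or.inl (hne 0 0))
  refine ⟨hg.differentiableAt, ?_⟩
  rw [hg.gradient]
  suffices h : ∃ i, 1 / 24 * (δ ^ 2 * Real.exp (-(18 * C ^ 2))) ≤ |gradComp μstar μ i| by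
    have hrate : polyRate (1 / 24) 18 C δ ≤ 1 / 24 * (δ ^ 2 * Real.exp (-(18 * C ^ 2))) := by
      unfold polyRate
      gcongr
      rw [show (18 : ℝ) = ((18 : ℕ) : ℝ) by norm_num, Real.rpow_natCast, div_pow, mul_pow,
        ← Real.exp_nat_mul]
      have e : Real.exp (((18 : ℕ) : ℝ) * -C ^ 2) = Real.exp (-(18 * C ^ 2)) := by
        congr 1; push_cast; ring
      rw [e]
      refine (div_le_self (by positivity) (one_le_pow₀ hC)).trans ?_
      gcongr ?_ * _
      exact pow_le_pow_of_le_one hδ.le (hδγ.trans hγ) (by norm_num)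
    obtain ⟨i, hi⟩ := h
    refine hrate.trans (hi.trans ?_)
    have := abs_le_norm_pair (gradComp μstar μ 0) (gradComp μstar μ 1)
    fin_cases i
    · exact this.1
    · exact this.2
  have hδ1 : δ ≤ 1 := hδγ.trans hγ
  have sep_m : δ ≤ μ 1 - μ 0 := by
    have : δ < |μ 0 - μ 1| := hmδ
    rw [abs_of_nonpos (by linarith)] at this
    linarith
  have sep_s : δ ≤ μstar 1 - μstar 0 := by
    have : γ < |μstar 0 - μstar 1| := hsγ
    rw [abs_of_nonpos (by linarith)] at this
    linarith
  have hs0 := abs_le.1 (hsC 0)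
  have hs1 := abs_le.1 (hsC 1)
  have hm0 := abs_le.1 (hmC 0)
  have hm1 := abs_le.1 (hmC 1)
  have hlow : ∀ t, |t| ≤ 2 * C →
      1 / 24 * (δ ^ 2 * Real.exp (-(18 * C ^ 2))) ≤ 1 / 2 * stdGauss t := by
    intro t ht
    have ht2 : t ^ 2 ≤ 4 * C ^ 2 := by
      rw [← sq_abs]; nlinarith [abs_nonneg t]
    have h1 := third_mul_le_stdGauss t
    have h2 : Real.exp (-(18 * C ^ 2)) ≤ Real.exp (-t ^ 2 / 2) := by
      gcongr
      nlinarith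
    have h3 : δ ^ 2 ≤ 1 := by nlinarith
    nlinarith [Real.exp_pos (-(18 * C ^ 2))]
  -- Equal directions are the shifted cases; opposite directions are the nested ones, with `σ`
  -- recording which pair is outer.
  rcases lt_or_gt_of_ne (hne 0 0) with h0 | h0 <;> rcases lt_or_gt_of_ne (hne 1 1) with h1 | h1
  · refine ⟨0, ?_⟩
    have := gradComp_zero_le hs hm h0 h1
    rw [abs_of_nonpos (this.trans (by nlinarith [stdGauss_pos (μstar 1 - μ 0)]))]
    have := hlow (μstar 1 - μ 0) (abs_le.2 ⟨by linarith, by linarith⟩)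
    linarith
  · refine exists_le_abs_gradComp_of_nested (o₁ := μ 0) (o₂ := μ 1) (i₁ := μstar 0)
      (i₂ := μstar 1) (σ := 1) hC hδ hδ1 h0 sep_s h1 hm0.1 hm1.2 (Or.inl rfl) sep_m hmC fun x => ?_
    rw [mixDiff_eq, bumpDiff]; ring
  · refine exists_le_abs_gradComp_of_nested (o₁ := μstar 0) (o₂ := μstar 1) (i₁ := μ 0)
      (i₂ := μ 1) (σ := -1) hC hδ hδ1 h0 sep_m h1 hs0.1 hs1.2 (Or.inr rfl) sep_m hmC fun x => ?_
    rw [mixDiff_eq, bumpDiff]; ring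
  · refine ⟨1, ?_⟩
    have := le_gradComp_one hs hm h0 h1
    refine le_trans (hlow (μstar 0 - μ 1) (abs_le.2 ⟨by linarith, by linarith⟩)) ?_
    exact this.trans (le_abs_self _)


/-! ### Sublevel sets of exponential sums. -/

/-- Integrate the derivative of `h' * arctan (h / η)`. Its part `h'² / (η (1 + (h/η)²))` is at least
`ε² / (2η)` on the set, while the boundary values and the `h''` term total at most `4B(1 + R)`;
Markov's inequality concludes without counting zeros of `h` or `h'`. -/
theorem volume_sublevel_le_of_deriv_ge {h h' h'' : ℝ → ℝ} {R B η ε : ℝ} (hR : 0 ≤ R) (hη : 0 < η)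
    (hε : 0 < ε) (hd : ∀ x, HasDerivAt h (h' x) x) (hd' : ∀ x, HasDerivAt h' (h'' x) x)
    (hc : Continuous h'') (hB' : ∀ x ∈ Icc (-R) R, |h' x| ≤ B)
    (hB'' : ∀ x ∈ Icc (-R) R, |h'' x| ≤ B) :
    volume.real {x ∈ Icc (-R) R | |h x| ≤ η ∧ ε ≤ |h' x|} ≤ 8 * η * B * (1 + R) / ε ^ 2 := by
  have hB : 0 ≤ B := (abs_nonneg _).trans (hB' R ⟨by linarith, le_rfl⟩)
  have hch : Continuous h := continuous_iff_continuousAt.2 fun x => (hd x).continuousAt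
  have hch' : Continuous h' := continuous_iff_continuousAt.2 fun x => (hd' x).continuousAt
  have hden : ∀ x, 1 + (h x / η) ^ 2 ≠ 0 := fun x => by positivity
  set J : ℝ → ℝ := fun x => h' x * (1 / (1 + (h x / η) ^ 2) * (h' x / η)) with hJ
  have hJc : Continuous J := by
    simp only [hJ]
    exact hch'.mul ((continuous_const.div (by fun_prop) hden).mul (by fun_prop))
  have hJ0 : ∀ x, 0 ≤ J x := fun x => by
    have : J x = h' x ^ 2 / ((1 + (h x / η) ^ 2) * η) := by
      simp only [hJ]; field_simp
    rw [this]; positivity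
  have hat : Continuous fun x => Real.arctan (h x / η) := by fun_prop
  have hF : ∀ x, HasDerivAt (fun x => h' x * Real.arctan (h x / η))
      (h'' x * Real.arctan (h x / η) + J x) x := fun x =>
    ((hd' x).mul ((hd x).div_const η).arctan)
  have hab : ∀ y : ℝ, |Real.arctan y| ≤ 2 := fun y => by
    have h1 := Real.neg_pi_div_two_lt_arctan y
    have h2 := Real.arctan_lt_pi_div_two y
    have := Real.pi_lt_four
    exact abs_le.2 ⟨by linarith, by linarith⟩
  have hFTC := intervalIntegral.integral_eq_sub_of_hasDerivAt (a := -R) (b := R) (fun x _ => hF x)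
    (((hc.mul hat).add hJc).intervalIntegrable _ _)
  have hch'' : Continuous fun x => h'' x * Real.arctan (h x / η) := hc.mul hat
  rw [intervalIntegral.integral_add (hch''.intervalIntegrable _ _)
    (hJc.intervalIntegrable _ _)] at hFTC
  have hRR : -R ≤ R := by linarith
  have h1 : |∫ x in -R..R, h'' x * Real.arctan (h x / η)| ≤ 2 * B * (2 * R) := by
    have := intervalIntegral.norm_integral_le_of_norm_le_const (a := -R) (b := R) (C := 2 * B)
      (f := fun x => h'' x * Real.arctan (h x / η)) (fun x hx => by
        rw [uIoc_of_le hRR] at hx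
        rw [Real.norm_eq_abs, abs_mul]
        nlinarith [hB'' x (Ioc_subset_Icc_self hx), hab (h x / η), abs_nonneg (h'' x),
          abs_nonneg (Real.arctan (h x / η))])
    rwa [Real.norm_eq_abs, abs_of_nonneg (by linarith : 0 ≤ R - -R),
      show R - -R = 2 * R by ring] at this
  have h2 : ∀ x ∈ Icc (-R) R, |h' x * Real.arctan (h x / η)| ≤ 2 * B := fun x hx => by
    rw [abs_mul]
    nlinarith [hB' x hx, hab (h x / η), abs_nonneg (h' x), abs_nonneg (Real.arctan (h x / η))]
  have hJint : ∫ x in Icc (-R) R, J x ≤ 4 * B * (1 + R) := by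
    rw [integral_Icc_eq_integral_Ioc, ← intervalIntegral.integral_of_le hRR]
    have a1 := abs_le.1 h1
    have a2 := abs_le.1 (h2 R ⟨hRR, le_rfl⟩)
    have a3 := abs_le.1 (h2 (-R) ⟨le_rfl, hRR⟩)
    linarith
  have hmark := mul_meas_ge_le_integral_of_nonneg (μ := volume.restrict (Icc (-R) R)) (f := J)
    (ae_of_all _ hJ0) (hJc.integrableOn_Icc) (ε ^ 2 / (2 * η))
  have hsub : volume.real {x ∈ Icc (-R) R | |h x| ≤ η ∧ ε ≤ |h' x|} ≤
      (volume.restrict (Icc (-R) R)).real {x | ε ^ 2 / (2 * η) ≤ J x} := by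
    rw [measureReal_restrict_apply (measurableSet_le measurable_const hJc.measurable)]
    refine measureReal_mono (fun x hx => ⟨?_, hx.1⟩)
      (ne_top_of_le_ne_top (measure_Icc_lt_top (a := -R) (b := R)).ne
        (measure_mono inter_subset_right))
    obtain ⟨-, hx1, hx2⟩ := hx
    have e1 : ε ^ 2 ≤ h' x ^ 2 := by
      rw [← sq_abs (h' x)]; exact pow_le_pow_left₀ hε.le hx2 2
    have e2 : (h x / η) ^ 2 ≤ 1 := by
      rw [div_pow, div_le_one (by positivity), ← sq_abs (h x)]
      exact pow_le_pow_left₀ (abs_nonneg _) hx1 2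
    have : J x = h' x ^ 2 / ((1 + (h x / η) ^ 2) * η) := by
      simp only [hJ]; field_simp
    simp only [mem_ofPred_eq]
    rw [this]
    gcongr
    linarith
  have hfin := hmark.trans hJint
  rw [le_div_iff₀ (by positivity)]
  calc _ ≤ (volume.restrict (Icc (-R) R)).real {x | ε ^ 2 / (2 * η) ≤ J x} * ε ^ 2 := by gcongr
    _ = (ε ^ 2 / (2 * η) * (volume.restrict (Icc (-R) R)).real {x | ε ^ 2 / (2 * η) ≤ J x}) *
        (2 * η) := by field_simp
    _ ≤ (4 * B * (1 + R)) * (2 * η) := by gcongr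
    _ = _ := by ring

/-- Exponential sum with four frequencies. -/
noncomputable def expSum (c m : Fin 4 → ℝ) (x : ℝ) : ℝ := ∑ j, c j * Real.exp (m j * x)

theorem hasDerivAt_expSum (c m : Fin 4 → ℝ) (x : ℝ) :
    HasDerivAt (expSum c m) (expSum (fun j => c j * m j) m x) x := by
  unfold expSum
  refine HasDerivAt.fun_sum fun j _ => ?_
  have := (((hasDerivAt_id x).const_mul (m j)).exp).const_mul (c j)
  exact this.congr_deriv (by simp; ring)

theorem continuous_expSum (c m : Fin 4 → ℝ) : Continuous (expSum c m) :=
  continuous_iff_continuousAt.2 fun x => (hasDerivAt_expSum c m x).continuousAt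

theorem expSum_mul_sub (c m : Fin 4 → ℝ) (a x : ℝ) :
    expSum (fun j => c j * (m j - a)) m x = expSum (fun j => c j * m j) m x - a * expSum c m x := by
  simp only [expSum, Finset.mul_sum, ← Finset.sum_sub_distrib]
  exact Finset.sum_congr rfl fun j _ => by ring

theorem abs_expSum_le {c m : Fin 4 → ℝ} {A C R x : ℝ} (hc : ∀ j, |c j| ≤ A) (hm : ∀ j, |m j| ≤ C)
    (hx : x ∈ Icc (-R) R) : |expSum c m x| ≤ 4 * A * Real.exp (C * R) := by
  refine (Finset.abs_sum_le_sum_abs _ _).trans ?_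
  have : ∀ j ∈ Finset.univ, |c j * Real.exp (m j * x)| ≤ A * Real.exp (C * R) := fun j _ => by
    rw [abs_mul, Real.abs_exp]
    have hA : 0 ≤ A := (abs_nonneg _).trans (hc j)
    have hmx : m j * x ≤ C * R := by
      refine (le_abs_self _).trans ?_
      rw [abs_mul]
      exact mul_le_mul (hm j) (abs_le.2 hx) (abs_nonneg _) ((abs_nonneg _).trans (hm j))
    exact mul_le_mul (hc j) (Real.exp_le_exp.2 hmx) (Real.exp_pos _).le hA
  refine (Finset.sum_le_sum this).trans ?_
  simp
  linarith

/-- Passing from `h` to `h' - a h` multiplies each coefficient by `m j - a`, which removes the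
frequency `a`. Where `|h| ≤ η`, the term `a h` is at most `ε/2`, so `|h'| ≥ ε/2`. -/
theorem volume_expSum_step {c m : Fin 4 → ℝ} {a A C R η ε : ℝ} (hC : 1 ≤ C) (hR : 0 ≤ R)
    (hη : 0 < η) (hε : 0 < ε) (hc : ∀ j, |c j| ≤ A) (hm : ∀ j, |m j| ≤ C) (ha : |a| ≤ C)
    (hηε : C * η ≤ ε / 2) :
    volume.real {x ∈ Icc (-R) R | |expSum c m x| ≤ η ∧
      ε ≤ |expSum (fun j => c j * (m j - a)) m x|} ≤
      128 * η * (A * C ^ 2 * Real.exp (C * R)) * (1 + R) / ε ^ 2 := by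
  have hA : 0 ≤ A := (abs_nonneg _).trans (hc 0)
  have hc1 : ∀ j, |c j * m j| ≤ A * C := fun j => by
    rw [abs_mul]; exact mul_le_mul (hc j) (hm j) (abs_nonneg _) hA
  have hc2 : ∀ j, |c j * m j * m j| ≤ A * C ^ 2 := fun j => by
    rw [abs_mul, pow_two, ← mul_assoc]
    exact mul_le_mul (hc1 j) (hm j) (abs_nonneg _) (by positivity)
  have hc1' : ∀ j, |c j * m j| ≤ A * C ^ 2 := fun j => (hc1 j).trans (by
    gcongr; nlinarith)
  have := volume_sublevel_le_of_deriv_ge (R := R) (B := 4 * (A * C ^ 2) * Real.exp (C * R))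
    hR hη (half_pos hε)
    (hasDerivAt_expSum c m) (hasDerivAt_expSum _ m) (continuous_expSum _ m)
    (fun x hx => abs_expSum_le hc1' hm hx) (fun x hx => abs_expSum_le hc2 hm hx)
  refine (measureReal_mono ?_ ?_).trans (this.trans (le_of_eq ?_))
  · rintro x ⟨hx, h1, h2⟩
    refine ⟨hx, h1, ?_⟩
    rw [expSum_mul_sub] at h2
    have h3 := abs_sub (expSum (fun j => c j * m j) m x) (a * expSum c m x)
    have h4 : |a * expSum c m x| ≤ C * η := by
      rw [abs_mul]; exact mul_le_mul ha h1 (abs_nonneg _) (by linarith)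
    linarith
  · exact ne_top_of_le_ne_top (measure_Icc_lt_top (a := -R) (b := R)).ne
      (measure_mono fun x hx => hx.1)
  · field_simp; ring

theorem abs_mul_sub_le {c m : Fin 4 → ℝ} {a A C : ℝ} (hc : ∀ j, |c j| ≤ A) (hm : ∀ j, |m j| ≤ C)
    (ha : |a| ≤ C) (j : Fin 4) : |c j * (m j - a)| ≤ A * (2 * C) := by
  rw [abs_mul]
  refine mul_le_mul (hc j) ((abs_sub _ _).trans ?_) (abs_nonneg _) ((abs_nonneg _).trans (hc j))
  linarith [hm j]

theorem fin_four_add_ne : ∀ i k : Fin 4, k ≠ 0 → i + k ≠ i := by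
  decide

theorem fin_four_eq_add : ∀ i j : Fin 4, j ≠ i → j = i + 1 ∨ j = i + 2 ∨ j = i + 3 := by
  decide

/-- Removing the three frequencies other than `m j₀` leaves one exponential of size at least `e₃`.
So a point where the sum is small must pass from small to large at one of the three stages. -/
theorem volume_expSum_sublevel {c m : Fin 4 → ℝ} {j₀ : Fin 4} {C R δ e₀ e₁ e₂ e₃ : ℝ} (hC : 1 ≤ C)
    (hR : 0 ≤ R) (hδ : 0 < δ) (h0 : 0 < e₀) (h1 : 0 < e₁) (h2 : 0 < e₂) (h3 : 0 < e₃)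
    (h01 : C * e₀ ≤ e₁ / 2) (h12 : C * e₁ ≤ e₂ / 2) (h23 : C * e₂ ≤ e₃ / 2)
    (hc : ∀ j, |c j| ≤ 1) (hm : ∀ j, |m j| ≤ C) (hc0 : Real.exp (-C ^ 2) ≤ |c j₀|)
    (hiso : ∀ j, j ≠ j₀ → δ / 2 ≤ |m j₀ - m j|)
    (he₃ : e₃ ≤ Real.exp (-C ^ 2) * (δ / 2) ^ 3 * Real.exp (-(C * R))) :
    volume.real {x ∈ Icc (-R) R | |expSum c m x| ≤ e₀} ≤
      1024 * C ^ 5 * Real.exp (C * R) * (1 + R) *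
        (e₀ / e₁ ^ 2 + e₁ / e₂ ^ 2 + e₂ / e₃ ^ 2) := by
  have n1 : j₀ + 1 ≠ j₀ := fin_four_add_ne j₀ 1 (by decide)
  have n2 : j₀ + 2 ≠ j₀ := fin_four_add_ne j₀ 2 (by decide)
  have n3 : j₀ + 3 ≠ j₀ := fin_four_add_ne j₀ 3 (by decide)
  set c1 : Fin 4 → ℝ := fun j => c j * (m j - m (j₀ + 1)) with hc1
  set c2 : Fin 4 → ℝ := fun j => c1 j * (m j - m (j₀ + 2)) with hc2
  set c3 : Fin 4 → ℝ := fun j => c2 j * (m j - m (j₀ + 3)) with hc3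
  have b1 : ∀ j, |c1 j| ≤ 1 * (2 * C) := abs_mul_sub_le hc hm (hm _)
  have b2 : ∀ j, |c2 j| ≤ 1 * (2 * C) * (2 * C) := abs_mul_sub_le b1 hm (hm _)
  have k0 : ∀ j, |c j| ≤ 8 * C ^ 3 := fun j => (hc j).trans (by nlinarith [one_le_pow₀ hC (n := 3)])
  have k1 : ∀ j, |c1 j| ≤ 8 * C ^ 3 := fun j => (b1 j).trans (by
    nlinarith [one_le_pow₀ hC (n := 2)])
  have k2 : ∀ j, |c2 j| ≤ 8 * C ^ 3 := fun j => (b2 j).trans (by nlinarith)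
  have s0 := volume_expSum_step hC hR h0 h1 k0 hm (hm (j₀ + 1)) h01
  have s1 := volume_expSum_step hC hR h1 h2 k1 hm (hm (j₀ + 2)) h12
  have s2 := volume_expSum_step hC hR h2 h3 k2 hm (hm (j₀ + 3)) h23
  have hbig : ∀ x ∈ Icc (-R) R, e₃ ≤ |expSum c3 m x| := by
    intro x hx
    have hz : ∀ j, j ≠ j₀ → c3 j = 0 := by
      intro j hj
      have : j = j₀ + 1 ∨ j = j₀ + 2 ∨ j = j₀ + 3 :=
        fin_four_eq_add j₀ j hj
      rcases this with rfl | rfl | rfl <;> simp [hc3, hc2, hc1]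
    have : expSum c3 m x = c3 j₀ * Real.exp (m j₀ * x) := by
      unfold expSum
      refine Finset.sum_eq_single _ (fun j _ hj => ?_) (by simp)
      rw [hz j hj, zero_mul]
    rw [this, abs_mul, Real.abs_exp]
    refine he₃.trans ?_
    have hx' : -(C * R) ≤ m j₀ * x := by
      have : |m j₀ * x| ≤ C * R := by
        rw [abs_mul]
        exact mul_le_mul (hm _) (abs_le.2 hx) (abs_nonneg _) (by linarith)
      exact (abs_le.1 this).1
    have : Real.exp (-C ^ 2) * (δ / 2) ^ 3 ≤ |c3 j₀| := by
      simp only [hc3, hc2, hc1, abs_mul]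
      calc Real.exp (-C ^ 2) * (δ / 2) ^ 3
          = Real.exp (-C ^ 2) * (δ / 2) * (δ / 2) * (δ / 2) := by ring
        _ ≤ _ := by gcongr <;> exact hiso _ ‹_›
    gcongr
  have hcover : {x ∈ Icc (-R) R | |expSum c m x| ≤ e₀} ⊆
      ({x ∈ Icc (-R) R | |expSum c m x| ≤ e₀ ∧ e₁ ≤ |expSum c1 m x|} ∪
       {x ∈ Icc (-R) R | |expSum c1 m x| ≤ e₁ ∧ e₂ ≤ |expSum c2 m x|}) ∪
       {x ∈ Icc (-R) R | |expSum c2 m x| ≤ e₂ ∧ e₃ ≤ |expSum c3 m x|} := by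
    rintro x ⟨hx, hx0⟩
    rcases le_or_gt e₁ |expSum c1 m x| with h | h
    · exact Or.inl (Or.inl ⟨hx, hx0, h⟩)
    · rcases le_or_gt e₂ |expSum c2 m x| with h' | h'
      · exact Or.inl (Or.inr ⟨hx, h.le, h'⟩)
      · exact Or.inr ⟨hx, h'.le, hbig x hx⟩
  have hfin : ∀ P : ℝ → Prop, volume {x ∈ Icc (-R) R | P x} ≠ ⊤ := fun P =>
    ne_top_of_le_ne_top (measure_Icc_lt_top (a := -R) (b := R)).ne
      (measure_mono fun x hx => hx.1)
  refine (measureReal_mono hcover (measure_union_ne_top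
    (measure_union_ne_top (hfin _) (hfin _)) (hfin _))).trans ?_
  refine (measureReal_union_le _ _).trans ?_
  refine (add_le_add (measureReal_union_le _ _) le_rfl).trans ?_
  refine (add_le_add (add_le_add s0 s1) s2).trans (le_of_eq ?_)
  ring

theorem exists_pow_volume_expSum_sublevel (N Q : ℕ) : ∃ M : ℕ, ∀ (t C R δ : ℝ) (c m : Fin 4 → ℝ)
    (j₀ : Fin 4), 0 < t → t ≤ 1 / 2 → 1 ≤ C → 0 ≤ R → t ≤ δ → t * C ≤ 1 →
    t * Real.exp (C ^ 2) ≤ 1 → t ^ N * Real.exp (R ^ 2) = 1 →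
    (∀ j, |c j| ≤ 1) → (∀ j, |m j| ≤ C) → Real.exp (-C ^ 2) ≤ |c j₀| →
    (∀ j, j ≠ j₀ → δ / 2 ≤ |m j₀ - m j|) →
    volume.real {x ∈ Icc (-R) R | |expSum c m x| ≤ t ^ M} ≤ t ^ Q := by
  -- With thresholds `t ^ b k` and `t ^ k`, the ratio `e / e'²` is `t ^ (17 + 2N)` times `t ^ (Q +
  -- 2)`. The first factor pays for the prefactor: 10 for 1024, 5 for `C⁵`, and `N + 1` each for
  -- `e^{CR}` and `1 + R`.
  set b : ℕ → ℕ := fun k => 2 * k + (17 + 2 * N) + (Q + 2) with hb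
  refine ⟨b (b (b (N + 8))), ?_⟩
  intro t C R δ c m j₀ ht ht2 hC hR htδ htC htE htN hc hm hc0 hiso
  have hCR : t ^ (N + 1) * Real.exp (C * R) ≤ 1 := by
    have h1 : Real.exp (C * R) ≤ Real.exp (R ^ 2) * Real.exp (C ^ 2) := by
      rw [← Real.exp_add]
      apply Real.exp_le_exp.2
      nlinarith [sq_nonneg (C - R), sq_nonneg (C + R)]
    calc t ^ (N + 1) * Real.exp (C * R)
        ≤ t ^ (N + 1) * (Real.exp (R ^ 2) * Real.exp (C ^ 2)) := by gcongr
      _ = (t ^ N * Real.exp (R ^ 2)) * (t * Real.exp (C ^ 2)) := by ring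
      _ ≤ 1 := by rw [htN, one_mul]; exact htE
  have hR1 : t ^ (N + 1) * (1 + R) ≤ 1 := by
    have h1 : 1 + R ≤ 2 * Real.exp (R ^ 2) := by
      nlinarith [Real.add_one_le_exp (R ^ 2), sq_nonneg (R - 1)]
    calc t ^ (N + 1) * (1 + R) ≤ t ^ (N + 1) * (2 * Real.exp (R ^ 2)) := by gcongr
      _ = (t ^ N * Real.exp (R ^ 2)) * (2 * t) := by ring
      _ ≤ 1 := by rw [htN, one_mul]; linarith
  have hL : t ^ (17 + 2 * N) * (1024 * C ^ 5 * Real.exp (C * R) * (1 + R)) ≤ 1 := by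
    have e1 : 1024 * t ^ 10 ≤ 1 := by
      have := pow_le_pow_left₀ ht.le ht2 10
      norm_num at this
      linarith
    have e2 : (t * C) ^ 5 ≤ 1 := pow_le_one₀ (by positivity) htC
    calc t ^ (17 + 2 * N) * (1024 * C ^ 5 * Real.exp (C * R) * (1 + R))
        = (1024 * t ^ 10) * (t * C) ^ 5 * (t ^ (N + 1) * Real.exp (C * R)) *
          (t ^ (N + 1) * (1 + R)) := by ring
      _ ≤ 1 * 1 * 1 * 1 := by gcongr
      _ = 1 := by ring
  have hstep : ∀ k, C * t ^ b k ≤ t ^ k / 2 := by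
    intro k
    have h1 : t ^ b k ≤ t ^ (k + 2) :=
      pow_le_pow_of_le_one ht.le (by linarith) (by simp only [hb]; omega)
    calc C * t ^ b k ≤ C * t ^ (k + 2) := by gcongr
      _ = t ^ k * (t * C) * t := by ring
      _ ≤ t ^ k * 1 * (1 / 2) := by gcongr
      _ = _ := by ring
  have hratio : ∀ k, 1024 * C ^ 5 * Real.exp (C * R) * (1 + R) * (t ^ b k / (t ^ k) ^ 2) ≤
      t ^ Q / 4 := by
    intro k
    have h1 : t ^ b k / (t ^ k) ^ 2 = t ^ (17 + 2 * N) * t ^ (Q + 2) := by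
      simp only [hb]
      field_simp
      ring
    rw [h1]
    calc _ = (t ^ (17 + 2 * N) * (1024 * C ^ 5 * Real.exp (C * R) * (1 + R))) *
          (t ^ Q * (t * t)) := by ring
      _ ≤ 1 * (t ^ Q * (1 / 2 * (1 / 2))) := by gcongr
      _ = _ := by ring
  -- Here `N + 8` is 1 for `e^{-C²}`, 6 for `(δ/2)³` and `N + 1` for `e^{-CR}`.
  have hlast : t ^ (N + 8) ≤ Real.exp (-C ^ 2) * (δ / 2) ^ 3 * Real.exp (-(C * R)) := by
    have f1 : t ≤ Real.exp (-C ^ 2) := by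
      rw [Real.exp_neg]; rwa [← le_div_iff₀ (Real.exp_pos _), one_div] at htE
    have f2 : t ^ (N + 1) ≤ Real.exp (-(C * R)) := by
      rw [Real.exp_neg]; rwa [← le_div_iff₀ (Real.exp_pos _), one_div] at hCR
    have f3 : t ^ 2 ≤ δ / 2 := by nlinarith
    calc t ^ (N + 8) = t * (t ^ 2) ^ 3 * t ^ (N + 1) := by ring
      _ ≤ _ := by
        have : 0 ≤ δ := (ht.trans_le htδ).le
        gcongr
  have hp : ∀ k : ℕ, 0 < t ^ k := fun k => pow_pos ht k
  refine (volume_expSum_sublevel hC hR (ht.trans_le htδ) (hp _) (hp _) (hp _) (hp _) (hstep _)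
    (hstep _) (hstep _) hc hm hc0 hiso hlast).trans ?_
  have r1 := hratio (b (b (N + 8)))
  have r2 := hratio (b (N + 8))
  have r3 := hratio (N + 8)
  have := hp Q
  rw [mul_add, mul_add]
  linarith


/-! ### Stability of the gradient under small moves of `μ`. -/

theorem stdGaussMoment_nonpos {t : ℝ} (h : t ≤ 0) : stdGaussMoment t ≤ 0 :=
  mul_nonpos_of_nonpos_of_nonneg h (stdGauss_pos t).le

theorem stdGaussMoment_nonneg {t : ℝ} (h : 0 ≤ t) : 0 ≤ stdGaussMoment t :=
  mul_nonneg h (stdGauss_pos t).le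

theorem abs_sign_sub_sign_le_two (a b : ℝ) :
    |((SignType.sign a : SignType) : ℝ) - ((SignType.sign b : SignType) : ℝ)| ≤ 2 := by
  refine (abs_sub _ _).trans ?_
  linarith [abs_sign_le_one a, abs_sign_le_one b]

theorem sign_eq_sign_of_abs_sub_lt {a b : ℝ} (h : |a - b| < |b|) :
    SignType.sign a = SignType.sign b := by
  rcases lt_trichotomy b 0 with hb | hb | hb
  · rw [abs_of_neg hb] at h
    have : a < 0 := by linarith [(abs_lt.1 h).2]
    simp [hb, this]
  · subst hb
    simp only [abs_zero] at h
    exact absurd h (not_lt.2 (abs_nonneg _))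
  · rw [abs_of_pos hb] at h
    have : 0 < a := by linarith [(abs_lt.1 h).1]
    simp [hb, this]

theorem abs_mixDiff_sub_le (μstar μ μ' : Params) (x : ℝ) :
    |mixDiff μstar μ' x - mixDiff μstar μ x| ≤ ‖μ' - μ‖ := by
  have h : ∀ i, |stdGauss (x - μ' i) - stdGauss (x - μ i)| ≤ ‖μ' - μ‖ := fun i => by
    refine (abs_stdGauss_sub_le _ _).trans ?_
    rw [sub_sub_sub_cancel_left, abs_sub_comm]
    exact abs_sub_le_norm_sub μ' μ i
  have h0 := abs_le.1 (h 0)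
  have h1 := abs_le.1 (h 1)
  rw [mixDiff_eq, mixDiff_eq, abs_le]
  constructor <;> linarith

/-- Outside `[-R, R]` the moments have constant sign and integrate to small Gaussian values. Inside,
the change splits into a Lipschitz change of the moment and a change of sign, the latter confined to
`|D| ≤ ρ`. -/
theorem abs_gradComp_sub_le {μstar μ μ' : Params} {C R : ℝ} (hR : 2 * C ≤ R) (hR0 : 0 ≤ R)
    (i : Fin 2) (hm : |μ i| ≤ C) (hm' : |μ' i| ≤ C) :
    |gradComp μstar μ' i - gradComp μstar μ i| ≤ Real.exp (-R ^ 2 / 8) + R * ‖μ' - μ‖ / 2 +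
      volume.real {x ∈ Icc (-R) R | |mixDiff μstar μ x| ≤ ‖μ' - μ‖} / 2 := by
  set s : ℝ → ℝ := fun x => ((SignType.sign (mixDiff μstar μ x) : SignType) : ℝ) with hs
  set s' : ℝ → ℝ := fun x => ((SignType.sign (mixDiff μstar μ' x) : SignType) : ℝ) with hs'
  set g : ℝ → ℝ := fun x => stdGaussMoment (x - μ i) with hg
  set g' : ℝ → ℝ := fun x => stdGaussMoment (x - μ' i) with hg'
  set ρ := ‖μ' - μ‖ with hρ
  set E := {x ∈ Icc (-R) R | |mixDiff μstar μ x| ≤ ρ} with hE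
  have hρ0 : 0 ≤ ρ := norm_nonneg _
  have hEm : MeasurableSet E := by
    rw [hE, ofPred_and]
    exact measurableSet_Icc.inter
      (measurableSet_le (continuous_mixDiff μstar μ).abs.measurable measurable_const)
  have hi : Integrable fun x => s x * g x := integrable_sign_mul_stdGaussMoment μstar μ (μ i)
  have hi' : Integrable fun x => s' x * g' x := integrable_sign_mul_stdGaussMoment μstar μ' (μ' i)
  have hgi : Integrable g := integrable_stdGaussMoment.comp_sub_right _
  have hgi' : Integrable g' := integrable_stdGaussMoment.comp_sub_right _
  have hd : Integrable fun x => |s' x * g' x - s x * g x| := (hi'.sub hi).abs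
  have hng : Integrable fun x => -g x := hgi.neg
  have hng' : Integrable fun x => -g' x := hgi'.neg
  have hs1 : ∀ x, |s x| ≤ 1 := fun x => abs_sign_le_one _
  have hs1' : ∀ x, |s' x| ≤ 1 := fun x => abs_sign_le_one _
  have htriv : ∀ x, |s' x * g' x - s x * g x| ≤ |g' x| + |g x| := fun x => by
    refine (abs_sub _ _).trans ?_
    rw [abs_mul, abs_mul]
    exact add_le_add (mul_le_of_le_one_left (abs_nonneg _) (hs1' x))
      (mul_le_of_le_one_left (abs_nonneg _) (hs1 x))
  have hmm := abs_le.1 hm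
  have hmm' := abs_le.1 hm'
  have hC0 : 0 ≤ C := (abs_nonneg _).trans hm
  have htail : ∀ u : ℝ, R / 2 ≤ |u| → stdGauss u ≤ 1 / 2 * Real.exp (-R ^ 2 / 8) := fun u hu => by
    refine (stdGauss_le_half_mul u).trans ?_
    have : (R / 2) ^ 2 ≤ u ^ 2 := by
      rw [← sq_abs u]; exact pow_le_pow_left₀ (by linarith) hu 2
    have : -u ^ 2 / 2 ≤ -R ^ 2 / 8 := by linarith
    gcongr
  have t1 : ∫ x in Iic (-R), |s' x * g' x - s x * g x| ≤ Real.exp (-R ^ 2 / 8) := by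
    calc ∫ x in Iic (-R), |s' x * g' x - s x * g x| ≤ ∫ x in Iic (-R), (-g' x + -g x) := by
          refine setIntegral_mono_on hd.integrableOn (hng'.add hng).integrableOn
            measurableSet_Iic fun x hx => ?_
          have hx : x ≤ -R := hx
          refine (htriv x).trans (le_of_eq ?_)
          rw [abs_of_nonpos (stdGaussMoment_nonpos (by linarith)),
            abs_of_nonpos (stdGaussMoment_nonpos (by linarith))]
      _ = stdGauss (-R - μ' i) + stdGauss (-R - μ i) := by
          rw [integral_add hng'.integrableOn hng.integrableOn, integral_neg, integral_neg,
            integral_Iic_stdGaussMoment, integral_Iic_stdGaussMoment, neg_neg, neg_neg]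
      _ ≤ _ := by
          have a1 := htail (-R - μ' i) (by rw [abs_of_nonpos (by linarith)]; linarith)
          have a2 := htail (-R - μ i) (by rw [abs_of_nonpos (by linarith)]; linarith)
          linarith
  have t3 : ∫ x in Ioi R, |s' x * g' x - s x * g x| ≤ Real.exp (-R ^ 2 / 8) := by
    calc ∫ x in Ioi R, |s' x * g' x - s x * g x| ≤ ∫ x in Ioi R, (g' x + g x) := by
          refine setIntegral_mono_on hd.integrableOn (hgi'.add hgi).integrableOn
            measurableSet_Ioi fun x hx => ?_
          have hx : R < x := hx
          refine (htriv x).trans (le_of_eq ?_)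
          rw [abs_of_nonneg (stdGaussMoment_nonneg (by linarith)),
            abs_of_nonneg (stdGaussMoment_nonneg (by linarith))]
      _ = stdGauss (R - μ' i) + stdGauss (R - μ i) := by
          rw [integral_add hgi'.integrableOn hgi.integrableOn,
            integral_Ioi_stdGaussMoment, integral_Ioi_stdGaussMoment]
      _ ≤ _ := by
          have a1 := htail (R - μ' i) (by rw [abs_of_nonneg (by linarith)]; linarith)
          have a2 := htail (R - μ i) (by rw [abs_of_nonneg (by linarith)]; linarith)
          linarith
  have t2 : ∫ x in Ioc (-R) R, |s' x * g' x - s x * g x| ≤ 2 * R * ρ + 2 * volume.real E := by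
    have hEfin : volume E ≠ ⊤ := ne_top_of_le_ne_top (measure_Icc_lt_top (a := -R) (b := R)).ne
      (measure_mono fun x hx => hx.1)
    have hIE : Integrable (E.indicator fun _ => (2 : ℝ)) :=
      (integrable_indicator_iff hEm).2 (integrableOn_const hEfin)
    have hcI : IntegrableOn (fun _ : ℝ => ρ) (Ioc (-R) R) := integrableOn_const measure_Ioc_lt_top.ne
    calc ∫ x in Ioc (-R) R, |s' x * g' x - s x * g x|
        ≤ ∫ x in Ioc (-R) R, (ρ + E.indicator (fun _ => (2 : ℝ)) x) := by
          refine setIntegral_mono_on hd.integrableOn (hcI.add hIE.integrableOn)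
            measurableSet_Ioc fun x hx => ?_
          have e1 : |s' x * (g' x - g x)| ≤ ρ := by
            rw [abs_mul]
            refine (mul_le_of_le_one_left (abs_nonneg _) (hs1' x)).trans ?_
            refine (abs_stdGaussMoment_sub_le _ _).trans ?_
            rw [sub_sub_sub_cancel_left, abs_sub_comm]
            exact abs_sub_le_norm_sub μ' μ i
          have e2 : |(s' x - s x) * g x| ≤ E.indicator (fun _ => (2 : ℝ)) x := by
            by_cases hxE : x ∈ E
            · rw [indicator_of_mem hxE, abs_mul]
              have b1 := abs_sign_sub_sign_le_two (mixDiff μstar μ' x) (mixDiff μstar μ x)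
              have b2 := abs_stdGaussMoment_le_one (x - μ i)
              calc _ ≤ (2 : ℝ) * 1 := mul_le_mul b1 b2 (abs_nonneg _) (by norm_num)
                _ = 2 := by norm_num
            · have : ρ < |mixDiff μstar μ x| := by
                by_contra! hc
                exact hxE ⟨Ioc_subset_Icc_self hx, hc⟩
              have : s' x = s x := by
                simp only [hs, hs']
                rw [sign_eq_sign_of_abs_sub_lt ((abs_mixDiff_sub_le μstar μ μ' x).trans_lt this)]
              rw [indicator_of_notMem hxE, this]
              simp
          calc |s' x * g' x - s x * g x| = |s' x * (g' x - g x) + (s' x - s x) * g x| := by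
                congr 1; ring
            _ ≤ _ := (abs_add_le _ _).trans (add_le_add e1 e2)
      _ = 2 * R * ρ + ∫ x in Ioc (-R) R, E.indicator (fun _ => (2 : ℝ)) x := by
          rw [integral_add hcI hIE.integrableOn, setIntegral_const]
          simp only [smul_eq_mul, Real.volume_real_Ioc]
          rw [max_eq_left (by linarith)]
          ring
      _ ≤ 2 * R * ρ + ∫ x, E.indicator (fun _ => (2 : ℝ)) x := by
          refine add_le_add le_rfl (setIntegral_le_integral hIE (ae_of_all _ fun x => ?_))
          exact indicator_nonneg (fun _ _ => by norm_num) x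
      _ = _ := by
          rw [integral_indicator hEm, setIntegral_const, smul_eq_mul]; ring
  have hmain : |(∫ x, s' x * g' x) - ∫ x, s x * g x| ≤
      2 * Real.exp (-R ^ 2 / 8) + 2 * R * ρ + 2 * volume.real E := by
    rw [← integral_sub hi' hi]
    refine (abs_integral_le_integral_abs).trans ?_
    rw [integral_eq_Iic_add_Ioc_add_Ioi hd (by linarith : -R ≤ R)]
    linarith
  have : gradComp μstar μ' i - gradComp μstar μ i =
      1 / 4 * ((∫ x, s' x * g' x) - ∫ x, s x * g x) := by
    simp only [gradComp, hs, hs', hg, hg']; ring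
  rw [this, abs_mul, abs_of_pos (by norm_num : (0 : ℝ) < 1 / 4)]
  have := Real.exp_pos (-R ^ 2 / 8)
  linarith

/-- Frequencies of the exponential sum attached to `mixDiff`. -/
def mixFreq (μstar μ : Params) : Fin 4 → ℝ := ![μ 0, μ 1, μstar 0, μstar 1]

/-- Coefficients of the exponential sum attached to `mixDiff`. -/
noncomputable def mixCoeff (μstar μ : Params) : Fin 4 → ℝ :=
  ![Real.exp (-(μ 0) ^ 2 / 2), Real.exp (-(μ 1) ^ 2 / 2), -Real.exp (-(μstar 0) ^ 2 / 2),
    -Real.exp (-(μstar 1) ^ 2 / 2)]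

theorem abs_mixCoeff (μstar μ : Params) (j : Fin 4) :
    |mixCoeff μstar μ j| = Real.exp (-(mixFreq μstar μ j) ^ 2 / 2) := by
  fin_cases j <;> simp [mixCoeff, mixFreq]

theorem expSum_mix_eq (μstar μ : Params) (x : ℝ) :
    expSum (mixCoeff μstar μ) (mixFreq μstar μ) x =
      2 * √(2 * Real.pi) * Real.exp (x ^ 2 / 2) * mixDiff μstar μ x := by
  have h : ∀ m : ℝ, √(2 * Real.pi) * (Real.exp (x ^ 2 / 2) * stdGauss (x - m)) =
      Real.exp (-m ^ 2 / 2) * Real.exp (m * x) := by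
    intro m
    have hpi : √(2 * Real.pi) ≠ 0 := by positivity
    rw [stdGauss, ← Real.exp_add, mul_left_comm (Real.exp (x ^ 2 / 2)), ← mul_assoc,
      mul_inv_cancel₀ hpi, one_mul, ← Real.exp_add]
    congr 1; ring
  rw [mixDiff_eq]
  simp only [expSum, Fin.sum_univ_four, mixCoeff, mixFreq]
  simp only [Matrix.cons_val]
  rw [neg_mul, neg_mul, ← h, ← h, ← h, ← h]
  ring

/-- One of `μ 0`, `μ 1` is isolated. Otherwise each has a neighbour within `δ/2`: a common neighbour
contradicts separation, crossed neighbours contradict the ordering, and matching ones contradict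
`hfar`. -/
theorem exists_isolated_freq {μstar μ : Params} {δ : ℝ} (hs : δ ≤ μstar 1 - μstar 0)
    (hm : δ ≤ μ 1 - μ 0) (hδ : 0 < δ) (hfar : ∃ i, δ ≤ |μ i - μstar i|) :
    ∃ j₀, ∀ j, j ≠ j₀ → δ / 2 ≤ |mixFreq μstar μ j₀ - mixFreq μstar μ j| := by
  by_contra! h
  obtain ⟨j, hj, hj'⟩ := h 0
  obtain ⟨k, hk, hk'⟩ := h 1
  have far : δ ≤ |μ 0 - μstar 0| ∨ δ ≤ |μ 1 - μstar 1| := by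
    obtain ⟨i, hi⟩ := hfar
    fin_cases i
    · exact Or.inl hi
    · exact Or.inr hi
  rw [abs_lt] at hj' hk'
  fin_cases j <;> fin_cases k <;> simp [mixFreq] at hj hk hj' hk' <;>
    first
    | linarith
    | (rcases far with h | h
       · rw [le_abs] at h
         rcases h with h | h <;> linarith
       · rw [le_abs] at h
         rcases h with h | h <;> linarith)

theorem exists_pow_abs_gradComp_sub_le {c : ℝ} (hc : 0 < c) (n : ℕ) : ∃ M : ℕ, 0 < M ∧
    ∀ C δ : ℝ, 1 ≤ C → 0 < δ → δ ≤ 1 → ∀ μstar μ μ' : Params,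
      μstar ∈ box C → μ ∈ box C → μ' ∈ box C → δ ≤ μstar 1 - μstar 0 → δ ≤ μ 1 - μ 0 →
      (∃ i, δ ≤ |μ i - μstar i|) → ‖μ' - μ‖ ≤ (δ * Real.exp (-C ^ 2) / C) ^ M →
      ∀ i, |gradComp μstar μ' i - gradComp μstar μ i| ≤ c * (δ * Real.exp (-C ^ 2) / C) ^ n := by
  -- Since `t ≤ 1/2`, the constant `c` is absorbed by `k` extra powers of `t`.
  obtain ⟨k, hk⟩ := exists_pow_lt_of_lt_one hc (by norm_num : (1 / 2 : ℝ) < 1)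
  set q := n + k with hq
  set N' := q + 2 with hN'
  obtain ⟨M₀, hM₀⟩ := exists_pow_volume_expSum_sublevel (8 * N') (q + 1)
  -- The power `8 * N'` cancels `e^{R²}`, and 3 pays for the constant 6 bounding `2√(2π)`.
  refine ⟨M₀ + 8 * N' + 3 + q + 1, by omega, ?_⟩
  intro C δ hC hδ hδ1 μstar μ μ' hsC hmC hmC' hs hm hfar hρ i
  set t := δ * Real.exp (-C ^ 2) / C with ht_def
  have ht : 0 < t := by positivity
  have htexp : t ≤ Real.exp (-C ^ 2) := by
    rw [ht_def, div_le_iff₀ (by linarith)]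
    have := Real.exp_pos (-C ^ 2)
    nlinarith
  have htC : t * C ≤ 1 := by
    have e : t * C = δ * Real.exp (-C ^ 2) := by rw [ht_def]; field_simp
    have : Real.exp (-C ^ 2) ≤ 1 := Real.exp_le_one_iff.2 (by nlinarith)
    rw [e]; nlinarith
  have htE : t * Real.exp (C ^ 2) ≤ 1 := by
    calc t * Real.exp (C ^ 2) ≤ Real.exp (-C ^ 2) * Real.exp (C ^ 2) := by gcongr
      _ = 1 := by rw [← Real.exp_add]; simp
  have ht2 : t ≤ 1 / 2 := by
    have : 2 ≤ Real.exp (C ^ 2) := by nlinarith [Real.add_one_le_exp (C ^ 2)]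
    nlinarith
  have htδ : t ≤ δ := by
    rw [ht_def, div_le_iff₀ (by linarith)]
    have : Real.exp (-C ^ 2) ≤ 1 := Real.exp_le_one_iff.2 (by nlinarith)
    nlinarith
  have hlog : C ^ 2 ≤ -Real.log t := by
    have := Real.log_le_log ht htexp
    rw [Real.log_exp] at this
    linarith
  -- Chosen so that the tail `e^{-R²/8}` equals `t ^ N'`; since `C² ≤ -log t`, also `R ≥ 2C`.
  set R := √(8 * N' * -Real.log t) with hR_def
  have hlog0 : 0 ≤ -Real.log t := by nlinarith
  have hR2 : R ^ 2 = 8 * N' * -Real.log t := Real.sq_sqrt (by positivity)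
  have hR0 : 0 ≤ R := Real.sqrt_nonneg _
  have hR2C : 2 * C ≤ R := by
    apply Real.le_sqrt_of_sq_le
    have : (2 : ℝ) ≤ N' := by rw [hN']; push_cast; linarith [(Nat.cast_nonneg q : (0 : ℝ) ≤ q)]
    nlinarith
  have hexpR : Real.exp (-R ^ 2 / 8) = t ^ N' := by
    rw [show -R ^ 2 / 8 = N' * Real.log t by rw [show -R ^ 2 = -(R ^ 2) by ring, hR2]; ring,
      Real.exp_nat_mul, Real.exp_log ht]
  have htN : t ^ (8 * N') * Real.exp (R ^ 2) = 1 := by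
    have : t ^ (8 * N') = Real.exp (-R ^ 2) := by
      rw [mul_comm, pow_mul, ← hexpR, ← Real.exp_nat_mul]; congr 1; push_cast; ring
    rw [this, ← Real.exp_add]; simp
  have hfreq : ∀ j, |mixFreq μstar μ j| ≤ C := by
    intro j
    fin_cases j
    · exact hmC 0
    · exact hmC 1
    · exact hsC 0
    · exact hsC 1
  have hcoef : ∀ j, Real.exp (-C ^ 2) ≤ |mixCoeff μstar μ j| ∧ |mixCoeff μstar μ j| ≤ 1 := by
    intro j
    rw [abs_mixCoeff]
    have h1 : mixFreq μstar μ j ^ 2 ≤ C ^ 2 := by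
      rw [← sq_abs]; exact pow_le_pow_left₀ (abs_nonneg _) (hfreq j) 2
    exact ⟨Real.exp_le_exp.2 (by nlinarith),
      Real.exp_le_one_iff.2 (by nlinarith [sq_nonneg (mixFreq μstar μ j)])⟩
  obtain ⟨j₀, hj₀⟩ := exists_isolated_freq hs hm hδ hfar
  have hvol := hM₀ t C R δ _ _ j₀ ht ht2 hC hR0 htδ htC htE htN (fun j => (hcoef j).2) hfreq
    (hcoef j₀).1 hj₀
  have hρ0 : 0 ≤ ‖μ' - μ‖ := norm_nonneg _
  have hvol' : volume.real {x ∈ Icc (-R) R | |mixDiff μstar μ x| ≤ ‖μ' - μ‖} ≤ t ^ (q + 1) := by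
    refine (measureReal_mono ?_ (ne_top_of_le_ne_top (measure_Icc_lt_top (a := -R) (b := R)).ne
      (measure_mono fun x hx => hx.1))).trans hvol
    rintro x ⟨hx, hxD⟩
    refine ⟨hx, ?_⟩
    have hx2 : x ^ 2 / 2 ≤ R ^ 2 := by
      have : x ^ 2 ≤ R ^ 2 := sq_le_sq' hx.1 hx.2
      nlinarith [sq_nonneg x]
    rw [expSum_mix_eq, abs_mul, abs_of_nonneg (by positivity)]
    calc 2 * √(2 * Real.pi) * Real.exp (x ^ 2 / 2) * |mixDiff μstar μ x|
        ≤ 2 * 3 * Real.exp (R ^ 2) * t ^ (M₀ + 8 * N' + 3 + q + 1) := by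
          gcongr
          · exact sqrt_two_pi_lt_three.le
          · exact hxD.trans hρ
      _ = (t ^ (8 * N') * Real.exp (R ^ 2)) * (6 * t ^ 3) * t ^ (q + 1) * t ^ M₀ := by ring
      _ ≤ 1 * 1 * 1 * t ^ M₀ := by
          rw [htN]
          have h3 : 6 * t ^ 3 ≤ 1 := by
            have := pow_le_pow_left₀ ht.le ht2 3
            norm_num at this
            linarith
          have h4 : t ^ (q + 1) ≤ 1 := pow_le_one₀ ht.le (by linarith)
          gcongr
      _ = t ^ M₀ := by ring
  have hRρ : R * ‖μ' - μ‖ ≤ t ^ q / 2 := by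
    have h1 : R ≤ Real.exp (R ^ 2) := by
      nlinarith [Real.add_one_le_exp (R ^ 2), sq_nonneg (R - 1)]
    calc R * ‖μ' - μ‖ ≤ Real.exp (R ^ 2) * t ^ (M₀ + 8 * N' + 3 + q + 1) := by gcongr
      _ = (t ^ (8 * N') * Real.exp (R ^ 2)) * t ^ (M₀ + 3) * t ^ q * t := by ring
      _ ≤ 1 * 1 * t ^ q * (1 / 2) := by
          rw [htN]
          have h4 : t ^ (M₀ + 3) ≤ 1 := pow_le_one₀ ht.le (by linarith)
          gcongr
      _ = _ := by ring
  refine (abs_gradComp_sub_le hR2C hR0 i (hmC i) (hmC' i)).trans ?_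
  rw [hexpR]
  have hq0 : 0 < t ^ q := pow_pos ht q
  have p1 : t ^ N' ≤ t ^ q / 4 := by
    calc t ^ N' = t ^ q * (t * t) := by rw [hN']; ring
      _ ≤ t ^ q * (1 / 2 * (1 / 2)) := by gcongr
      _ = _ := by ring
  have p2 : t ^ (q + 1) ≤ t ^ q / 2 := by
    calc t ^ (q + 1) = t ^ q * t := by ring
      _ ≤ t ^ q * (1 / 2) := by gcongr
      _ = _ := by ring
  have p3 : t ^ q ≤ c * t ^ n := by
    calc t ^ q = t ^ k * t ^ n := by rw [hq]; ring
      _ ≤ (1 / 2) ^ k * t ^ n := by gcongr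
      _ ≤ c * t ^ n := by gcongr
  linarith

/-! ### Gradient bounds at shared coordinates, and the theorem. -/

theorem norm_pair_sub_le (a b a' b' : ℝ) :
    ‖(!₂[a', b'] : Params) - !₂[a, b]‖ ≤ |a' - a| + |b' - b| := by
  rw [EuclideanSpace.norm_eq, Fin.sum_univ_two]
  apply Real.sqrt_le_iff.2
  refine ⟨by positivity, ?_⟩
  simp only [PiLp.sub_apply, Real.norm_eq_abs]
  simp
  nlinarith [abs_nonneg (a' - a), abs_nonneg (b' - b), sq_abs (a' - a), sq_abs (b' - b)]

theorem exists_far_coordinate {μstar μ : Params} {δ : ℝ} (h : μ ∉ uniSet μstar δ) :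
    ∃ i, δ ≤ |μ i - μstar i| := by
  by_contra! hc
  exact h hc

theorem le_sub_of_mem_sepSet {v : Params} {δ : ℝ} (hv : v 0 ≤ v 1) (h : v ∈ sepSet δ) :
    δ < v 1 - v 0 := by
  have h : δ < |v 0 - v 1| := h
  rwa [abs_of_nonpos (by linarith), neg_sub] at h

theorem polyRate_le_norm_gradient {c p C δ : ℝ} (hgb : IsGradBound c p) (hC : 1 ≤ C) (hδ : 0 < δ)
    (hδ1 : δ ≤ 1) {μstar μ : Params} (hs : μstar 0 ≤ μstar 1) (hm : μ 0 ≤ μ 1)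
    (hss : μstar ∈ sepSet δ) (hms : μ ∈ sepSet δ) (hsC : μstar ∈ box C) (hmC : μ ∈ box C)
    (hfar : ∃ i, δ ≤ |μ i - μstar i|) :
    polyRate c p C δ ≤ ‖gradient (tvLoss μstar) μ‖ := by
  have hss' := le_sub_of_mem_sepSet hs hss
  have hms' := le_sub_of_mem_sepSet hm hms
  have hne : μ 0 ≠ μstar 0 ∨ μ 1 ≠ μstar 1 := by
    by_contra! h
    obtain ⟨i, hi⟩ := hfar
    fin_cases i <;> simp [h.1, h.2] at hi <;> linarith
  refine le_of_forall_pos_le_add fun e he => ?_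
  -- Power 0 turns the stability estimate into plain continuity with error `e / 2` per coordinate.
  obtain ⟨M, -, hM⟩ := exists_pow_abs_gradComp_sub_le (half_pos he) 0
  set t := δ * Real.exp (-C ^ 2) / C with ht
  have htp : 0 < t ^ M := by positivity
  set b := min (t ^ M / 2) ((μ 1 - μ 0 - δ) / 2) with hb
  have hb0 : 0 < b := lt_min (by linarith) (by linarith)
  obtain ⟨ε, hε, hεn⟩ := (Ioo_infinite hb0).exists_notMem_finset
    {μstar 0 - μ 0, μstar 1 - μ 0, μ 1 - μstar 0, μ 1 - μstar 1}
  simp only [Finset.mem_insert, Finset.mem_singleton, not_or] at hεn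
  obtain ⟨n1, n2, n3, n4⟩ := hεn
  have hε1 : ε < t ^ M / 2 := hε.2.trans_le (min_le_left _ _)
  have hε2 : ε < (μ 1 - μ 0 - δ) / 2 := hε.2.trans_le (min_le_right _ _)
  have hε0 := hε.1
  -- Moving both means inward stays in the box, and `ε` is small enough to keep the strict
  -- separation; the four excluded values of `ε` are those creating a shared coordinate.
  set ν : Params := !₂[μ 0 + ε, μ 1 - ε] with hν
  have ν0 : ν 0 = μ 0 + ε := by simp [hν]
  have ν1 : ν 1 = μ 1 - ε := by simp [hν]
  have hm0 := abs_le.1 (hmC 0)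
  have hm1 := abs_le.1 (hmC 1)
  have hνC : ν ∈ box C := by
    intro i
    rw [abs_le]
    fin_cases i
    · simp only [Fin.zero_eta, ν0]; constructor <;> linarith
    · simp only [Fin.mk_one, ν1]; constructor <;> linarith
  have hνs : ν 0 ≤ ν 1 := by rw [ν0, ν1]; linarith
  have hνne : ∀ i j, ν i ≠ μstar j := by
    intro i j h
    fin_cases i <;> fin_cases j <;> simp only [Fin.zero_eta, Fin.mk_one, ν0, ν1] at h
    · exact n1 (by linarith)
    · exact n2 (by linarith)
    · exact n3 (by linarith)
    · exact n4 (by linarith)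
  have hνsep : ν ∈ sepSet δ := by
    change δ < |ν 0 - ν 1|
    rw [abs_of_nonpos (by linarith), ν0, ν1]; linarith
  have hνμ : ‖ν - μ‖ ≤ t ^ M := by
    have e : (!₂[μ 0, μ 1] : Params) = μ := by
      ext i; fin_cases i <;> simp
    have := norm_pair_sub_le (μ 0) (μ 1) (μ 0 + ε) (μ 1 - ε)
    rw [e] at this
    refine this.trans ?_
    rw [show μ 0 + ε - μ 0 = ε by ring, show μ 1 - ε - μ 1 = -ε by ring, abs_neg, abs_of_pos hε0]
    linarith
  -- The separation parameter is taken to be `δ`, which is at most 1 as `IsGradBound` demands.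
  have hlow := (hgb C δ δ hC hδ1 le_rfl hδ μstar ν hs hνs hνne hsC hνC hss hνsep).2
  have hd := hM C δ hC hδ hδ1 μstar μ ν hsC hmC hνC hss'.le hms'.le hfar hνμ
  rw [(hasGradientAt_tvLoss_of_ne hs hνs (Or.inl (hνne 0 0))).gradient] at hlow
  rw [(hasGradientAt_tvLoss_of_ne hs hm hne).gradient]
  have h1 := norm_pair_sub_le (gradComp μstar μ 0) (gradComp μstar μ 1) (gradComp μstar ν 0)
    (gradComp μstar ν 1)
  have h2 := norm_le_insert' (!₂[gradComp μstar ν 0, gradComp μstar ν 1] : Params)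
    !₂[gradComp μstar μ 0, gradComp μstar μ 1]
  have h3 := hd 0
  have h4 := hd 1
  rw [pow_zero, mul_one] at h3 h4
  linarith

theorem mainTheorem5 :
    (∃ c p : ℝ, 0 < c ∧ 0 < p ∧ IsGradBound c p) ∧
    ∀ c p : ℝ, 0 < c → 0 < p → IsGradBound c p →
      ∃ c' p' δ₀ : ℝ, 0 < c' ∧ 0 < p' ∧ 0 < δ₀ ∧
        ∀ C γ δ : ℝ, 1 ≤ C → δ ≤ γ → 0 < δ → δ ≤ δ₀ →
          ∀ μstar μ μ' : Params,
            μstar 0 ≤ μstar 1 → μ 0 ≤ μ 1 → μ' 0 ≤ μ' 1 →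
            segment ℝ μ μ' ∩ uniSet μstar δ = ∅ →
            μstar ∈ sepSet γ → μ' ∈ sepSet δ → μ ∈ sepSet δ →
            μstar ∈ box C → μ ∈ box C → μ' ∈ box C →
            ‖μ' - μ‖ ≤ polyRate c' p' C δ →
            DifferentiableAt ℝ (tvLoss μstar) μ ∧
            DifferentiableAt ℝ (tvLoss μstar) μ' ∧
            ‖gradient (tvLoss μstar) μ' - gradient (tvLoss μstar) μ‖ ≤ polyRate c p C δ / 2 ∧
            polyRate c p C δ / 2 ≤ ‖gradient (tvLoss μstar) μ‖ / 2 := by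
  refine ⟨⟨1 / 24, 18, by norm_num, by norm_num, isGradBound_explicit⟩, ?_⟩
  intro c p hc hp hgb
  obtain ⟨n, hn⟩ := exists_nat_ge p
  -- Error `c / 4` in each of two coordinates adds up to `c / 2`; the integer `n ≥ p` is harmless
  -- because the base is at most 1.
  obtain ⟨M, hM0, hM⟩ := exists_pow_abs_gradComp_sub_le (c := c / 4) (by linarith) n
  refine ⟨1, M, 1, one_pos, by exact_mod_cast hM0, one_pos, ?_⟩
  intro C γ δ hC hδγ hδ hδ1 μstar μ μ' hs hm hm' hseg hsγ hms' hms hsC hmC hmC' hρ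
  have hss : μstar ∈ sepSet δ := lt_of_le_of_lt hδγ hsγ
  have hfarOf : ∀ v ∈ segment ℝ μ μ', ∃ i, δ ≤ |v i - μstar i| := fun v hv =>
    exists_far_coordinate fun hu => (eq_empty_iff_forall_notMem.1 hseg v) ⟨hv, hu⟩
  have hfar := hfarOf μ (left_mem_segment ℝ μ μ')
  have hfar' := hfarOf μ' (right_mem_segment ℝ μ μ')
  have hneOf : ∀ v : Params, (∃ i, δ ≤ |v i - μstar i|) → v 0 ≠ μstar 0 ∨ v 1 ≠ μstar 1 := by
    rintro v ⟨i, hi⟩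
    by_contra! h
    fin_cases i <;> simp [h.1, h.2] at hi <;> linarith
  have hg := hasGradientAt_tvLoss_of_ne hs hm (hneOf μ hfar)
  have hg' := hasGradientAt_tvLoss_of_ne hs hm' (hneOf μ' hfar')
  refine ⟨hg.differentiableAt, hg'.differentiableAt, ?_, ?_⟩
  · rw [hg.gradient, hg'.gradient]
    rw [polyRate, one_mul, Real.rpow_natCast] at hρ
    have hd := hM C δ hC hδ hδ1 μstar μ μ' hsC hmC hmC' (le_sub_of_mem_sepSet hs hss).le
      (le_sub_of_mem_sepSet hm hms).le hfar hρ
    have h0 := hd 0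
    have h1 := hd 1
    refine (norm_pair_sub_le _ _ _ _).trans ?_
    have ht0 : 0 < δ * Real.exp (-C ^ 2) / C := by positivity
    have ht1 : δ * Real.exp (-C ^ 2) / C ≤ 1 := by
      rw [div_le_one (by linarith)]
      have : Real.exp (-C ^ 2) ≤ 1 := Real.exp_le_one_iff.2 (by nlinarith)
      nlinarith [Real.exp_pos (-C ^ 2)]
    have hpow : (δ * Real.exp (-C ^ 2) / C) ^ n ≤ (δ * Real.exp (-C ^ 2) / C) ^ p := by
      rw [← Real.rpow_natCast]
      exact Real.rpow_le_rpow_of_exponent_ge ht0 ht1 hn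
    have := mul_le_mul_of_nonneg_left hpow hc.le
    unfold polyRate
    linarith
  · have := polyRate_le_norm_gradient hgb hC hδ hδ1 hs hm hss hms hsC hmC hfar
    linarith
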